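/- **Setting.** Let $(X,d,|\cdot|)$ be a space of homogeneous type: $d$ is a quasimetric whose balls are open and $|\cdot|$ is a doubling Borel measure for which balls have positive finite measure. Let $\mathscr Q=\bigcup_{n\in\mathbb Z}\mathscr Q_n$ be a system of dyadic cubes in $X$ in the sense of Christ and David. Its parameter is $q\in(0,1)$, so a cube $A\in\mathscr Q_n$ contains, and is contained in, balls around its center of radii comparable to $q^n$. Write $\operatorname{lev}A=n$ for $A\in\mathscr Q_n$; a cube is understood together with its level. For a collection $\mathscr S$ of sets let $\mathscr S^*$ be its union. Let $E$ be a UMD Banach space over $\mathbb R$ or $\mathbb C$, let $1<p<\infty$, and fix constants $K_1,K_2,\varepsilon>0$ and $C_g\ge 1$. Let $\lambda,M$ be positive integers. For $A\in\mathscr Q$ and $1\le m\le M$ let $\mathscr S_\lambda^{(m)}(A)$ be a subset of $\{B\in\mathscr Q_{\operatorname{lev}A+\lambda}: B\subset A\}$ such that * (S1) $A=\bigcup_{m=1}^M\mathscr S_\lambda^{(m)}(A)^*$ up to a null set, and the union is disjoint; * (S2) $|\mathscr S_\lambda^{(m)}(A)^*|\le K_1|\mathscr S_\lambda^{(n)}(A)^*|$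 for $1\le m,n\le M$; * (S3) for each $m$ the family $\{\mathscr S_\lambda^{(m)}(A)^*:A\in\mathscr Q\}$ is nested: the intersection of two members is one of them or empty; * (S4) $\big|\bigcup\{B\in\mathscr Q_{\operatorname{lev}A+j}: B\cap\mathscr S_\lambda^{(m)}(A)^*\ne\emptyset\}\big|\le K_2q^{j\varepsilon}|A|$ for $1\le m\le M$ and $0\le j\le\lambda-1$. Let $h_A$ and $g_{A,\lambda}^{(m)}$ ($A\in\mathscr Q$, $1\le m\le M$) be scalar functions in $L^p(X)$ such that * (M) $h_A$ vanishes a.e. outside $A$, and $\{h_A:A\in\mathscr Q\}$ is a martingale difference sequence for some linear order of the index set and some $\sigma$-finite filtration; * (G1) $g_{A,\lambda}^{(m)}$ vanishes a.e. outside $\mathscr S_\lambda^{(m)}(A)^*$; * (G2) $\{g_{A,\lambda}^{(m)}:A\in\mathscr Q,\ 1\le m\le M\}$ is a martingale difference sequence in the same sense; * (G3) $\|g_{A,\lambda}^{(m)}\|_\infty\le C_g\,|\mathscr S_\lambda^{(n)}(A)^*|^{-1}\int|g_{A,\lambda}^{(n)}|$ for $A\in\mathscr Q$ and $m\ne n$.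 The stripe operator $S_\lambda^{(m)}$ is the linear extension $\sum_A f_Ah_A\mapsto\sum_A f_A\,g_{A,\lambda}^{(m)}$ (finite sums, $f_A\in E$) of $S_\lambda^{(m)}h_A=g_{A,\lambda}^{(m)}$. It is extended by closing its graph in $L_E^p(X)\times L_E^p(X)$; "$u=S_\lambda^{(m)}f$" means that $(f,u)$ lies in this closure. Let $\overline{\operatorname{lin}}\{h_P\}$ be the closure in $L^p_E(X)$ of the set of these finite sums $\sum_A f_A h_A$. **Theorem.** 1. Suppose $L_E^p(X)$ has cotype $\mathcal C\in[2,\infty)$. Then there is a constant $C>0$, depending only on $p$, $E$, $\mathcal C$, $X$ (with its cubes) and $K_1,K_2,\varepsilon,C_g$, such that the following holds for all $\lambda$, $M$, stripes and functions as above and every $C_S>0$. If $$\Big\|\sum_{n=1}^M S_\lambda^{(n)}h_Q\Big\|_\infty\le C_S\,\frac1{|Q|}\int|h_Q|\qquad\text{for all }Q\in\mathscr Q,$$ then for all $1\le m\le M$ and all $f\in\overline{\operatorname{lin}}\{h_P\}$ the value $S_\lambda^{(m)}f$ exists, is unique, and satisfies $$\|S_\lambda^{(m)}f\|_{L_E^p(X)}\le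 C\,C_S\,M^{-1/\mathcal C}\,\|f\|_{L_E^p(X)}.$$ 2. Suppose $L_E^p(X)$ has type $\mathcal T\in[1,2]$. Then there is a constant $C>0$, depending only on $p$, $E$, $\mathcal T$, $X$ (with its cubes) and $K_1,K_2,\varepsilon,C_g$, such that the following holds for all $\lambda$, $M$, stripes and functions as above and every $C_S>0$. If $$\|h_Q\|_\infty\le C_S\sum_{n=1}^M\frac1{|Q|}\int|S_\lambda^{(n)}h_Q|\qquad\text{for all }Q\in\mathscr Q,$$ then for all $1\le m\le M$ and all $f,u\in L^p_E(X)$ with $u=S_\lambda^{(m)}f$ (in particular for all finite sums $f=\sum_A f_Ah_A$, $u=\sum_A f_A\,g_{A,\lambda}^{(m)}$) $$\|u\|_{L_E^p(X)}\ge C\,C_S^{-1}\,M^{-1/\mathcal T}\,\|f\|_{L_E^p(X)}.$$ -/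

import Mathlib

open MeasureTheory Set
open scoped ENNReal NNReal

universe u v

noncomputable section

/-! ### Spaces of homogeneous type -/

/-- A quasimetric `d` on `X`, with quasi-triangle constant `K ≥ 1`. -/
structure QuasiMetric (X : Type u) where
  d : X → X → ℝ
  d_nonneg : ∀ x y, 0 ≤ d x y
  d_eq_zero : ∀ x y, d x y = 0 ↔ x = y
  d_comm : ∀ x y, d x y = d y x
  K : ℝ
  one_le_K : 1 ≤ K
  d_triangle : ∀ x y z, d x y ≤ K * (d x z + d z y)

/-- The ball `B(x,r) = {y : d(x,y) < r}`. -/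
def QuasiMetric.ball {X : Type u} (ρ : QuasiMetric X) (x : X) (r : ℝ) : Set X :=
  {y | ρ.d x y < r}

/-- `A` is open if every point of `A` is the center of a ball contained in `A`. -/
def QuasiMetric.QOpen {X : Type u} (ρ : QuasiMetric X) (A : Set X) : Prop :=
  ∀ x ∈ A, ∃ r : ℝ, 0 < r ∧ ρ.ball x r ⊆ A

/-- A space of homogeneous type: a quasimetric space all of whose balls are open, with a Borel
measure satisfying the doubling condition. -/
structure HomogeneousSpace (X : Type u) [mX : MeasurableSpace X] extends QuasiMetric X where
  ball_open : ∀ (x : X) (r : ℝ), toQuasiMetric.QOpen (toQuasiMetric.ball x r)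
  borel : mX = MeasurableSpace.generateFrom {A | toQuasiMetric.QOpen A}
  vol : Measure X
  Cd : ℝ
  Cd_pos : 0 < Cd
  vol_ball_pos : ∀ (x : X) (r : ℝ), 0 < r → 0 < vol (toQuasiMetric.ball x (2 * r))
  doubling : ∀ (x : X) (r : ℝ), 0 < r →
    vol (toQuasiMetric.ball x (2 * r)) ≤ ENNReal.ofReal Cd * vol (toQuasiMetric.ball x r)
  vol_ball_lt_top : ∀ (x : X) (r : ℝ), 0 < r → vol (toQuasiMetric.ball x r) < ∞

/-! ### Dyadic cubes -/

/-- A system of dyadic cubes in the sense of Christ and David; `cubes n` is the collection of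
cubes of level `n`. -/
structure DyadicSystem {X : Type u} [MeasurableSpace X] (H : HomogeneousSpace X) where
  cubes : ℤ → Set (Set X)
  q : ℝ
  q_pos : 0 < q
  q_lt_one : q < 1
  C1 : ℝ
  C1_pos : 0 < C1
  C2 : ℝ
  C2_pos : 0 < C2
  C3 : ℝ
  C3_pos : 0 < C3
  η : ℝ
  η_pos : 0 < η
  N : ℕ
  center : ℤ → Set X → X
  open_cube : ∀ n, ∀ A ∈ cubes n, H.toQuasiMetric.QOpen A
  center_mem : ∀ n, ∀ A ∈ cubes n, center n A ∈ A
  cover : ∀ n, H.vol (⋃₀ cubes n)ᶜ = 0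
  nested : ∀ k n, k ≤ n → ∀ A ∈ cubes k, ∀ B ∈ cubes n, B ⊆ A ∨ A ∩ B = ∅
  ancestor : ∀ k n, k ≤ n → ∀ B ∈ cubes n, ∃! A, A ∈ cubes k ∧ B ⊆ A
  ball_subset : ∀ n, ∀ A ∈ cubes n, H.toQuasiMetric.ball (center n A) (C1 * q ^ n) ⊆ A
  subset_ball : ∀ n, ∀ A ∈ cubes n, A ⊆ H.toQuasiMetric.ball (center n A) (C2 * q ^ n)
  /-- The distance to the complement is an infimum in `[0,∞]`, hence infinite if `A = X`. -/
  boundary : ∀ n, ∀ A ∈ cubes n, ∀ t : ℝ, 0 < t →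
    H.vol {x ∈ A | (⨅ y ∈ Aᶜ, ENNReal.ofReal (H.d x y)) ≤ ENNReal.ofReal (t * q ^ n)}
      < ENNReal.ofReal (C3 * t ^ η) * H.vol A
  countable_cubes : ∀ n, (cubes n).Countable
  children_le : ∀ n, ∀ A ∈ cubes n, {B ∈ cubes (n + 1) | B ⊆ A}.encard ≤ N
  children_cover : ∀ n, ∀ A ∈ cubes n, ∃ S ⊆ cubes (n + 1), S.encard ≤ N ∧
    A =ᵐ[H.vol] (⋃₀ S : Set X)

/-- A dyadic cube together with its level. -/
structure DyadicSystem.Cube {X : Type u} [MeasurableSpace X] {H : HomogeneousSpace X}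
    (D : DyadicSystem H) where
  lev : ℤ
  carrier : Set X
  mem : carrier ∈ D.cubes lev

/-! ### Martingale differences, UMD, type and cotype -/

/-- `d` is a martingale difference sequence on the (`σ`-finite) measure space `(Ω, μ)`, indexed by
a linear order. -/
def IsMDS {Ω : Type u} {m : MeasurableSpace Ω} {ι F : Type*} [LinearOrder ι]
    [NormedAddCommGroup F] [NormedSpace ℝ F] [CompleteSpace F]
    (μ : Measure Ω) (d : ι → Ω → F) : Prop :=
  ∃ ℱ : Filtration ι m, SigmaFiniteFiltration μ ℱ ∧
    (∀ i, StronglyMeasurable[ℱ i] (d i)) ∧ (∀ i, Integrable (d i) μ) ∧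
    ∀ i j, j < i → μ[d i | ℱ j] =ᵐ[μ] 0

/-- A family (without a preferred order) constitutes a martingale difference sequence if it is one
for some linear order on its index set. -/
def ConstitutesMDS {Ω : Type u} {m : MeasurableSpace Ω} {ι F : Type*}
    [NormedAddCommGroup F] [NormedSpace ℝ F] [CompleteSpace F]
    (μ : Measure Ω) (d : ι → Ω → F) : Prop :=
  ∃ _ : LinearOrder ι, IsMDS μ d

/-- The UMD property of a Banach space: for every `1 < p < ∞`, changes of signs of finite
`L^p` martingale difference sequences are bounded, uniformly in the sequence. -/
def IsUMD (E : Type v) [NormedAddCommGroup E] [NormedSpace ℝ E] [CompleteSpace E] : Prop :=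
  ∀ p : ℝ≥0∞, 1 < p → p ≠ ∞ → ∃ β : ℝ≥0,
    ∀ (Ω : Type u) (_ : MeasurableSpace Ω) (μ : Measure Ω), SigmaFinite μ →
    ∀ (n : ℕ) (d : Fin n → Ω → E), IsMDS μ d → (∀ i, MemLp (d i) p μ) →
    ∀ ε : Fin n → ℤˣ,
      eLpNorm (fun ω => ∑ i, ε i • d i ω) p μ ≤ β * eLpNorm (fun ω => ∑ i, d i ω) p μ

/-- The Rademacher average `∫₀¹ ‖∑ᵢ rᵢ(t) xᵢ‖ dt`, as an average over all choices of signs. -/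
def rademacherAvg {Y : Type*} [NormedAddCommGroup Y] {n : ℕ} (x : Fin n → Y) : ℝ :=
  (2 ^ n : ℝ)⁻¹ * ∑ ε : Fin n → ℤˣ, ‖∑ i, ε i • x i‖

/-- `Y` has (Rademacher) type `t`, where `1 ≤ t ≤ 2`. -/
def HasType (Y : Type*) [NormedAddCommGroup Y] (t : ℝ) : Prop :=
  1 ≤ t ∧ t ≤ 2 ∧ ∃ c : ℝ, ∀ (n : ℕ) (x : Fin n → Y),
    rademacherAvg x ≤ c * (∑ i, ‖x i‖ ^ t) ^ (1 / t)

/-- `Y` has (Rademacher) cotype `c`, where `2 ≤ c < ∞`. -/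
def HasCotype (Y : Type*) [NormedAddCommGroup Y] (c : ℝ) : Prop :=
  2 ≤ c ∧ ∃ c' : ℝ, ∀ (n : ℕ) (x : Fin n → Y),
    (∑ i, ‖x i‖ ^ c) ^ (1 / c) ≤ c' * rademacherAvg x

/-! ### Stripes -/

/-- Stripes `S_lam^{(m)}(A)`: collections of cubes of level `lev A + lam` contained in `A`.  The
stripes of index `1, …, M` are indexed by `Fin M`. -/
structure Stripes {X : Type u} [MeasurableSpace X] {H : HomogeneousSpace X} (D : DyadicSystem H)
    (lam M : ℕ) (K₁ K₂ ε : ℝ) where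
  stripe : Fin M → D.Cube → Set (Set X)
  stripe_subset : ∀ m A, stripe m A ⊆ {B | B ∈ D.cubes (A.lev + lam) ∧ B ⊆ A.carrier}
  /-- `A` is the disjoint union of the stripes, up to a null set -/
  disjoint : ∀ A m n, m ≠ n → Disjoint (⋃₀ stripe m A) (⋃₀ stripe n A)
  cover : ∀ A, H.vol (A.carrier \ ⋃ m, ⋃₀ stripe m A) = 0
  comparable : ∀ A m n, H.vol (⋃₀ stripe m A) ≤ ENNReal.ofReal K₁ * H.vol (⋃₀ stripe n A)
  nested : ∀ m A B, (⋃₀ stripe m A) ∩ (⋃₀ stripe m B) = ⋃₀ stripe m A ∨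
    (⋃₀ stripe m A) ∩ (⋃₀ stripe m B) = ⋃₀ stripe m B ∨
    (⋃₀ stripe m A) ∩ (⋃₀ stripe m B) = ∅
  /-- the cubes of level `lev A + j` meeting the stripe have small total measure -/
  decay : ∀ m (A : D.Cube) (j : ℕ), j < lam →
    H.vol (⋃₀ {B | B ∈ D.cubes (A.lev + j) ∧ (B ∩ ⋃₀ stripe m A).Nonempty})
      ≤ ENNReal.ofReal (K₂ * D.q ^ ((j : ℝ) * ε)) * H.vol A.carrier

/-- The functions `h_A` and the stripe functions `g_{A,lam}^{(m)}`, all of them in `L^p`. -/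
structure StripeFunctions {X : Type u} [MeasurableSpace X] {H : HomogeneousSpace X}
    {D : DyadicSystem H} {lam M : ℕ} {K₁ K₂ ε : ℝ} (S : Stripes D lam M K₁ K₂ ε)
    (𝕜 : Type*) [RCLike 𝕜] (p : ℝ≥0∞) (Cg : ℝ) where
  h : D.Cube → X → 𝕜
  g : Fin M → D.Cube → X → 𝕜
  h_memLp : ∀ A, MemLp (h A) p H.vol
  g_memLp : ∀ m A, MemLp (g m A) p H.vol
  h_supp : ∀ A, ∀ᵐ x ∂H.vol, x ∉ A.carrier → h A x = 0
  h_mds : ConstitutesMDS H.vol h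
  g_supp : ∀ m A, ∀ᵐ x ∂H.vol, x ∉ ⋃₀ S.stripe m A → g m A x = 0
  g_mds : ConstitutesMDS H.vol (fun i : Fin M × D.Cube => g i.1 i.2)
  g_bound : ∀ A m n, m ≠ n → eLpNorm (g m A) ∞ H.vol ≤
    ENNReal.ofReal Cg * ((H.vol (⋃₀ S.stripe n A))⁻¹ * ∫⁻ x, ‖g n A x‖ₑ ∂H.vol)

/-! ### The stripe operators on `L^p(X; E)` -/

section Operators

variable {X : Type u} [MeasurableSpace X] {𝕜 : Type*} [RCLike 𝕜]
  (E : Type v) [NormedAddCommGroup E] [NormedSpace 𝕜 E]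

theorem memLp_smul_vec {p : ℝ≥0∞} {μ : Measure X} {φ : X → 𝕜} (hφ : MemLp φ p μ) (x : E) :
    MemLp (fun ω => φ ω • x) p μ :=
  ((ContinuousLinearMap.id 𝕜 𝕜).smulRight x).comp_memLp' hφ

/-- The map `x ↦ φ x` from `E` to `L^p(X; E)`, for a scalar function `φ ∈ L^p`. -/
def vecMul {p : ℝ≥0∞} {μ : Measure X} {φ : X → 𝕜} (hφ : MemLp φ p μ) :
    E →ₗ[𝕜] Lp E p μ where
  toFun x := (memLp_smul_vec E hφ x).toLp (fun ω => φ ω • x)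
  map_add' x y := by
    rw [← MemLp.toLp_add]
    congr 1
    funext ω
    simp [smul_add]
  map_smul' c x := by
    rw [RingHom.id_apply, ← MemLp.toLp_const_smul]
    congr 1
    funext ω
    simp [smul_comm c (φ ω) x]

/-- The finite sums `∑_A f_A φ_A` with coefficients `f_A ∈ E`, as elements of `L^p(X; E)`. -/
def synthesis {ι : Type*} {p : ℝ≥0∞} {μ : Measure X} {φ : ι → X → 𝕜}
    (hφ : ∀ i, MemLp (φ i) p μ) : (ι →₀ E) →ₗ[𝕜] Lp E p μ :=
  Finsupp.lsum 𝕜 fun i => vecMul E (hφ i)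

variable {H : HomogeneousSpace X} {D : DyadicSystem H} {lam M : ℕ} {K₁ K₂ ε : ℝ}
  {S : Stripes D lam M K₁ K₂ ε} {p : ℝ≥0∞} [Fact (1 ≤ p)] {Cg : ℝ}

/-- The closed linear span in `L^p(X; E)` of the functions `h_A` (with coefficients in `E`). -/
def StripeFunctions.closedSpan (F : StripeFunctions S 𝕜 p Cg) : Submodule 𝕜 (Lp E p H.vol) :=
  (LinearMap.range (synthesis E F.h_memLp)).topologicalClosure

/-- The graph of the stripe operator `S_lam^{(m)}`: the closure in `L^p × L^p` of the graph
`{(∑_A f_A h_A, ∑_A f_A g_A^{(m)})}` of the linear extension of `h_A ↦ g_A^{(m)}`.  So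
`(f, u)` belongs to it if and only if there are finite sums with `∑_A f_A h_A → f` and
`S_lam^{(m)} (∑_A f_A h_A) = ∑_A f_A g_A^{(m)} → u`. -/
def StripeFunctions.graph (F : StripeFunctions S 𝕜 p Cg) (m : Fin M) :
    Submodule 𝕜 (Lp E p H.vol × Lp E p H.vol) :=
  (LinearMap.range ((synthesis E F.h_memLp).prod
    (synthesis E (F.g_memLp m)))).topologicalClosure

end Operators

end

/-! Martingale differences in a UMD space are unconditional, so the `L^p` norms of the sums in
question are comparable to their randomized norms `signNorm`. Randomized norms obey two rules: the
contraction principle, and Stein's inequality for conditional expectations. Averages over a nested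
family of sets are conditional expectations along a suitable filtration. Hence functions `φ k`
supported in nested sets `U k` dominate, in randomized norm, all functions `ψ k` on `U k` whose sup
norms are bounded by the averages of `|φ k|` (`IsUMDBound.signNorm_smul_le_of_average`).

With the cubes as nested family, this turns the hypothesis on `C_S` into an inequality between the
norms of `f` and of `∑ n, S^(n) f`. It remains to pass from the sum to a single summand. By (G2),
signs on the summands change the norm of the sum by a bounded factor only, so this norm is
comparable to the Rademacher average of the `M` vectors `S^(n) f`. If these vectors have comparable
norms, cotype `𝒞` bounds `M^(1/𝒞) ‖S^(m) f‖` by the average, and type `𝒯` bounds the average by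
`M^(1/𝒯) ‖S^(m) f‖`, up to constants.

The heart of the matter is that comparability, `StripeFunctions.eLpNorm_sum_smul_le`. Condition (G3)
relates `g^(m)` to `g^(n)`, but they live on disjoint stripes, and the unions of two stripes need
not be nested. The cubes are therefore split into `2k` classes, by the level modulo `k` and by the
parity of the block of `lam` levels that contains it. Within a class, the two stripes of each cube
are stripped of those of the deeper cubes in the same block. The remaining cores are nested, and by
the decay (S4) they keep half of each stripe if `k` is large, independently of `lam`. Stein's
inequality on stripes, on cores and again on stripes then leads from `g^(m)` to `g^(n)`. All
estimates are made on finite sums and pass to the closed graph. -/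

noncomputable section

/-! ### Signs and the contraction principle -/

theorem units_smul_eq_real_smul {E : Type*} [NormedAddCommGroup E] [NormedSpace ℝ E]
    (e : ℤˣ) (x : E) : e • x = ((e : ℤ) : ℝ) • x := by
  rcases Int.units_eq_one_or e with h | h <;> simp [h]

theorem units_smul_comm_smul {E R : Type*} [AddCommGroup E] [Monoid R] [DistribMulAction R E]
    (e : ℤˣ) (r : R) (x : E) : e • r • x = r • e • x := by
  rcases Int.units_eq_one_or e with h | h <;> simp [h]

theorem convexOn_norm_rpow_sum {E ι : Type*} [NormedAddCommGroup E] [NormedSpace ℝ E]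
    [Fintype ι] [DecidableEq ι] {q : ℝ} (hq : 1 ≤ q) (a : ι → E) :
    ConvexOn ℝ univ fun c : ι → ℝ => ∑ ε : ι → ℤˣ, ‖∑ i, ε i • c i • a i‖ ^ q := by
  have hsum : ∀ t : Finset (ι → ℤˣ),
      ConvexOn ℝ univ fun c : ι → ℝ => ∑ ε ∈ t, ‖∑ i, ε i • c i • a i‖ ^ q := by
    intro t
    induction t using Finset.induction_on with
    | empty => simpa using convexOn_const (𝕜 := ℝ) (0 : ℝ) convex_univ
    | insert ε t hε ih =>
      simp only [Finset.sum_insert hε]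
      refine ConvexOn.add ⟨convex_univ, fun x _ y _ s t hs ht hst => ?_⟩ ih
      have h1 : ‖∑ i, ε i • (s • x + t • y) i • a i‖
          ≤ s * ‖∑ i, ε i • x i • a i‖ + t * ‖∑ i, ε i • y i • a i‖ := by
        have : ∑ i, ε i • (s • x + t • y) i • a i
            = s • ∑ i, ε i • x i • a i + t • ∑ i, ε i • y i • a i := by
          rw [Finset.smul_sum, Finset.smul_sum, ← Finset.sum_add_distrib]
          refine Finset.sum_congr rfl fun i _ => ?_
          simp only [units_smul_eq_real_smul, Pi.add_apply, Pi.smul_apply, smul_eq_mul, smul_smul,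
            ← add_smul]
          congr 1
          ring
        rw [this]
        refine (norm_add_le _ _).trans ?_
        rw [norm_smul, norm_smul, Real.norm_of_nonneg hs, Real.norm_of_nonneg ht]
      refine (Real.rpow_le_rpow (norm_nonneg _) h1 (by linarith)).trans ?_
      exact (convexOn_rpow hq).2 (norm_nonneg _) (norm_nonneg _) hs ht hst
  exact hsum Finset.univ

/-- A convex function on the cube `[-1,1]^ι` is bounded at each point by its value at some vertex.
At a vertex the coefficients are themselves signs and merely permute the choices `ε`, so the value
there is the right-hand side. -/
theorem sum_signs_norm_rpow_real_smul_le {E ι : Type*} [NormedAddCommGroup E] [NormedSpace ℝ E]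
    [Fintype ι] [DecidableEq ι] {q : ℝ} (hq : 1 ≤ q) (a : ι → E) (c : ι → ℝ) (hc : ∀ i, |c i| ≤ 1) :
    ∑ ε : ι → ℤˣ, ‖∑ i, ε i • c i • a i‖ ^ q ≤ ∑ ε : ι → ℤˣ, ‖∑ i, ε i • a i‖ ^ q := by
  have hmem : c ∈ convexHull ℝ (Set.univ.pi fun _ : ι => ({-1, 1} : Set ℝ)) := by
    rw [convexHull_pi]
    intro i _
    rw [convexHull_pair, segment_eq_Icc (by norm_num)]
    exact abs_le.1 (hc i)
  obtain ⟨y, hy, hle⟩ := (convexOn_norm_rpow_sum hq a).exists_ge_of_mem_convexHull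
    (subset_univ _) hmem
  refine hle.trans (le_of_eq ?_)
  have hy' : ∀ i, ∃ e : ℤˣ, y i = ((e : ℤ) : ℝ) := by
    intro i
    rcases hy i (mem_univ i) with h | h
    · exact ⟨-1, by simpa using h⟩
    · exact ⟨1, by simpa using h⟩
  choose e he using hy'
  refine Fintype.sum_equiv (Equiv.mulRight e) _ _ fun ε => ?_
  congr 2
  refine Finset.sum_congr rfl fun i _ => ?_
  rw [he, ← units_smul_eq_real_smul, smul_smul]
  rfl

/-- The real and imaginary parts of `c` are treated separately. The constant `2 ^ q` is `2 ^ (q -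
1)`, from the convexity of `t ^ q`, times the number of parts. -/
theorem sum_signs_norm_rpow_smul_le {E ι 𝕜 : Type*} [RCLike 𝕜] [NormedAddCommGroup E]
    [NormedSpace ℝ E] [NormedSpace 𝕜 E] [IsScalarTower ℝ 𝕜 E]
    [Fintype ι] [DecidableEq ι] {q : ℝ} (hq : 1 ≤ q) (a : ι → E) (c : ι → 𝕜) (hc : ∀ i, ‖c i‖ ≤ 1) :
    ∑ ε : ι → ℤˣ, ‖∑ i, ε i • c i • a i‖ ^ q ≤
      2 ^ q * ∑ ε : ι → ℤˣ, ‖∑ i, ε i • a i‖ ^ q := by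
  have hre := sum_signs_norm_rpow_real_smul_le hq a (fun i => RCLike.re (c i))
    fun i => (RCLike.abs_re_le_norm _).trans (hc i)
  have him := sum_signs_norm_rpow_real_smul_le hq a (fun i => RCLike.im (c i))
    fun i => (RCLike.abs_im_le_norm _).trans (hc i)
  have key : ∀ ε : ι → ℤˣ, ‖∑ i, ε i • c i • a i‖ ^ q ≤
      2 ^ (q - 1) * (‖∑ i, ε i • RCLike.re (c i) • a i‖ ^ q
        + ‖∑ i, ε i • RCLike.im (c i) • a i‖ ^ q) := by
    intro ε
    have h1 : ∑ i, ε i • c i • a i = ∑ i, ε i • RCLike.re (c i) • a i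
        + (RCLike.I : 𝕜) • ∑ i, ε i • RCLike.im (c i) • a i := by
      rw [Finset.smul_sum, ← Finset.sum_add_distrib]
      refine Finset.sum_congr rfl fun i _ => ?_
      rw [← units_smul_comm_smul, ← smul_add]
      congr 1
      rw [RCLike.real_smul_eq_coe_smul (K := 𝕜), RCLike.real_smul_eq_coe_smul (K := 𝕜), smul_smul,
        ← add_smul]
      congr 1
      rw [mul_comm, RCLike.re_add_im]
    have h2 : ‖∑ i, ε i • c i • a i‖ ≤ ‖∑ i, ε i • RCLike.re (c i) • a i‖
        + ‖∑ i, ε i • RCLike.im (c i) • a i‖ := by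
      rw [h1]
      refine (norm_add_le _ _).trans (add_le_add le_rfl ?_)
      rw [norm_smul]
      refine mul_le_of_le_one_left (norm_nonneg _) (by rw [RCLike.norm_I]; split_ifs <;> simp)
    refine (Real.rpow_le_rpow (norm_nonneg _) h2 (by linarith)).trans ?_
    have h3 := NNReal.rpow_add_le_mul_rpow_add_rpow ‖∑ i, ε i • RCLike.re (c i) • a i‖₊
      ‖∑ i, ε i • RCLike.im (c i) • a i‖₊ hq
    exact_mod_cast h3
  refine (Finset.sum_le_sum fun ε _ => key ε).trans ?_
  rw [← Finset.mul_sum, Finset.sum_add_distrib]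
  have h3 : (2 : ℝ) ^ q = 2 ^ (q - 1) * 2 := by
    rw [← Real.rpow_add_one (by norm_num), sub_add_cancel]
  rw [h3, mul_assoc]
  gcongr
  linarith

/-! ### Randomized `L^p` norms -/

/-- The `L^p` norm of the randomized sum `∑ i, ε i • f i`, where the choices of signs carry the
counting measure. -/
def signNorm {X E ι : Type*} [MeasurableSpace X] [NormedAddCommGroup E] [Fintype ι]
    [DecidableEq ι] (p : ℝ≥0∞)
    (μ : Measure X) (f : ι → X → E) : ℝ≥0∞ :=
  (∑ ε : ι → ℤˣ, eLpNorm (fun x => ∑ i, ε i • f i x) p μ ^ p.toReal) ^ (1 / p.toReal)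

theorem sum_rpow_le_of_le {κ : Type*} [Fintype κ] {q : ℝ} (hq : 0 < q) {u w : κ → ℝ≥0∞}
    {C : ℝ≥0∞} (h : ∀ k, u k ≤ C * w k) :
    (∑ k, u k ^ q) ^ (1 / q) ≤ C * (∑ k, w k ^ q) ^ (1 / q) := by
  have : ∑ k, u k ^ q ≤ C ^ q * ∑ k, w k ^ q := by
    rw [Finset.mul_sum]
    refine Finset.sum_le_sum fun k _ => ?_
    rw [← ENNReal.mul_rpow_of_nonneg _ _ hq.le]
    exact ENNReal.rpow_le_rpow (h k) hq.le
  refine (ENNReal.rpow_le_rpow this (by positivity)).trans ?_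
  rw [ENNReal.mul_rpow_of_nonneg _ _ (by positivity), ← ENNReal.rpow_mul,
    mul_one_div_cancel hq.ne', ENNReal.rpow_one]

theorem aestronglyMeasurable_sum_units_smul {X E ι : Type*} [MeasurableSpace X]
    [NormedAddCommGroup E] [Fintype ι] {μ : Measure X} {f : ι → X → E}
    (hf : ∀ i, AEStronglyMeasurable (f i) μ) (ε : ι → ℤˣ) :
    AEStronglyMeasurable (fun x => ∑ i, ε i • f i x) μ := by
  refine Finset.aestronglyMeasurable_fun_sum _ fun i _ => ?_
  rcases Int.units_eq_one_or (ε i) with h | h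
  · simpa [h] using hf i
  · simpa [h] using (hf i).fun_neg

section signNorm

variable {X E ι : Type*} [MeasurableSpace X] [NormedAddCommGroup E] [Fintype ι] [DecidableEq ι]
  {p : ℝ≥0∞}
  {μ : Measure X}

theorem toReal_pos_of_one_le (hp : 1 ≤ p) (hp' : p ≠ ∞) : 0 < p.toReal :=
  ENNReal.toReal_pos (zero_lt_one.trans_le hp).ne' hp'

theorem one_le_toReal (hp : 1 ≤ p) (hp' : p ≠ ∞) : 1 ≤ p.toReal := by
  rw [← ENNReal.toReal_one]
  exact ENNReal.toReal_mono hp' hp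

theorem signNorm_congr {f g : ι → X → E} (h : ∀ i, f i =ᵐ[μ] g i) :
    signNorm p μ f = signNorm p μ g := by
  unfold signNorm
  congr 1
  refine Finset.sum_congr rfl fun ε _ => ?_
  congr 1
  refine eLpNorm_congr_ae ?_
  filter_upwards [ae_all_iff.2 h] with x hx
  simp [hx]

theorem signNorm_reindex {κ : Type*} [Fintype κ] [DecidableEq κ] (e : κ ≃ ι) (f : ι → X → E) :
    signNorm p μ (fun k => f (e k)) = signNorm p μ f := by
  unfold signNorm
  congr 1
  refine Fintype.sum_equiv (e.arrowCongr (Equiv.refl _)) _ _ fun ε => ?_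
  congr 2
  funext x
  refine Fintype.sum_equiv e _ _ fun k => ?_
  simp

/-- Since the `p`-th powers are summed over the signs, sum and integral can be exchanged; randomized
norms can then be estimated pointwise in `x`. -/
theorem signNorm_eq_lintegral (hp : 1 ≤ p) (hp' : p ≠ ∞) {f : ι → X → E}
    (hf : ∀ i, AEStronglyMeasurable (f i) μ) :
    signNorm p μ f
      = (∫⁻ x, ∑ ε : ι → ℤˣ, ‖∑ i, ε i • f i x‖ₑ ^ p.toReal ∂μ) ^ (1 / p.toReal) := by
  have h0 : p ≠ 0 := (zero_lt_one.trans_le hp).ne'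
  have hq := toReal_pos_of_one_le hp hp'
  unfold signNorm
  rw [lintegral_finsetSum']
  · congr 1
    refine Finset.sum_congr rfl fun ε _ => ?_
    rw [eLpNorm_eq_lintegral_rpow_enorm_toReal h0 hp', ← ENNReal.rpow_mul,
      one_div_mul_cancel hq.ne', ENNReal.rpow_one]
  · intro ε _
    exact (aestronglyMeasurable_sum_units_smul hf ε).enorm.pow_const _

theorem ofReal_sum_norm_rpow {q : ℝ} (hq : 0 ≤ q) (a : (ι → ℤˣ) → E) :
    ENNReal.ofReal (∑ ε, ‖a ε‖ ^ q) = ∑ ε, ‖a ε‖ₑ ^ q := by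
  rw [ENNReal.ofReal_sum_of_nonneg fun _ _ => by positivity]
  refine Finset.sum_congr rfl fun ε _ => ?_
  rw [← ofReal_norm, ENNReal.ofReal_rpow_of_nonneg (norm_nonneg _) hq]

/-- **Contraction principle** -/
theorem signNorm_le_of_smul {𝕜 : Type*} [RCLike 𝕜] [NormedSpace ℝ E] [NormedSpace 𝕜 E]
    [IsScalarTower ℝ 𝕜 E] (hp : 1 ≤ p) (hp' : p ≠ ∞) {f g : ι → X → E}
    (hf : ∀ i, AEStronglyMeasurable (f i) μ) (hg : ∀ i, AEStronglyMeasurable (g i) μ)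
    (h : ∀ i, ∀ᵐ x ∂μ, ∃ c : 𝕜, ‖c‖ ≤ 1 ∧ f i x = c • g i x) :
    signNorm p μ f ≤ 2 * signNorm p μ g := by
  have hq := toReal_pos_of_one_le hp hp'
  rw [signNorm_eq_lintegral hp hp' hf, signNorm_eq_lintegral hp hp' hg]
  have : ∫⁻ x, ∑ ε : ι → ℤˣ, ‖∑ i, ε i • f i x‖ₑ ^ p.toReal ∂μ
      ≤ 2 ^ p.toReal * ∫⁻ x, ∑ ε : ι → ℤˣ, ‖∑ i, ε i • g i x‖ₑ ^ p.toReal ∂μ := by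
    rw [← lintegral_const_mul' _ _ (by simp)]
    refine lintegral_mono_ae ?_
    filter_upwards [ae_all_iff.2 h] with x hx
    choose c hc hfc using hx
    simp only [hfc]
    rw [← ofReal_sum_norm_rpow hq.le, ← ofReal_sum_norm_rpow hq.le]
    have h2 : (2 : ℝ≥0∞) ^ p.toReal = ENNReal.ofReal (2 ^ p.toReal) := by
      rw [← ENNReal.ofReal_rpow_of_nonneg (by norm_num) hq.le]
      norm_num
    rw [h2, ← ENNReal.ofReal_mul (by positivity)]
    exact ENNReal.ofReal_le_ofReal
      (sum_signs_norm_rpow_smul_le (one_le_toReal hp hp') (fun i => g i x) c hc)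
  refine (ENNReal.rpow_le_rpow this (by positivity)).trans ?_
  rw [ENNReal.mul_rpow_of_nonneg _ _ (by positivity), ← ENNReal.rpow_mul,
    mul_one_div_cancel hq.ne', ENNReal.rpow_one]

end signNorm

/-! ### Martingale differences -/

theorem IsMDS.comp_strictMono {Ω : Type u} {m : MeasurableSpace Ω} {ι κ F : Type*} [LinearOrder ι]
    [LinearOrder κ] [NormedAddCommGroup F] [NormedSpace ℝ F] [CompleteSpace F]
    {μ : Measure Ω} {d : ι → Ω → F} (hd : IsMDS μ d) {e : κ → ι} (he : StrictMono e) :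
    IsMDS μ (fun k => d (e k)) := by
  obtain ⟨ℱ, hℱ, hm, hi, hc⟩ := hd
  exact ⟨⟨fun k => ℱ (e k), fun _ _ h => ℱ.mono (he.monotone h), fun k => ℱ.le (e k)⟩,
    ⟨fun k => hℱ.SigmaFinite (e k)⟩, fun k => hm (e k), fun k => hi (e k),
    fun i j hij => hc (e i) (e j) (he hij)⟩

theorem ConstitutesMDS.comp_injective {Ω : Type u} {m : MeasurableSpace Ω} {ι κ F : Type*}
    [NormedAddCommGroup F] [NormedSpace ℝ F] [CompleteSpace F]
    {μ : Measure Ω} {d : ι → Ω → F} (hd : ConstitutesMDS μ d) {e : κ → ι}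
    (he : Function.Injective e) : ConstitutesMDS μ (fun k => d (e k)) := by
  obtain ⟨o, hd⟩ := hd
  let _ : LinearOrder κ := LinearOrder.lift' e he
  exact ⟨inferInstance, hd.comp_strictMono fun _ _ h => h⟩

/-- Conditional expectation commutes with the bounded real-linear map `c ↦ c • a i`. -/
theorem ConstitutesMDS.smul_vec {Ω : Type u} {m : MeasurableSpace Ω} {ι 𝕜 E : Type*} [RCLike 𝕜]
    [NormedAddCommGroup E] [NormedSpace ℝ E] [NormedSpace 𝕜 E] [IsScalarTower ℝ 𝕜 E]
    [CompleteSpace E] {μ : Measure Ω} {φ : ι → Ω → 𝕜} (hφ : ConstitutesMDS μ φ) (a : ι → E) :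
    ConstitutesMDS μ (fun i ω => φ i ω • a i) := by
  obtain ⟨o, ℱ, hℱ, hm, hi, hc⟩ := hφ
  let T : E → 𝕜 →L[ℝ] E := fun x =>
    ((ContinuousLinearMap.id 𝕜 𝕜).smulRight x).restrictScalars ℝ
  refine ⟨o, ℱ, hℱ, fun i => (hm i).smul_const (a i), fun i => (hi i).smul_const (a i),
    fun i j hij => ?_⟩
  have h1 := (T (a i)).comp_condExp_comm (m := ℱ j) (hi i)
  have h2 : (T (a i)) ∘ φ i = fun ω => φ i ω • a i := by
    funext ω
    simp [T]
  rw [h2] at h1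
  filter_upwards [h1, hc i j hij] with ω h3 h4
  rw [← h3, Function.comp_apply, h4]
  simp

/-- `β` is a constant in the UMD property for the exponent `p`. -/
def IsUMDBound (E : Type v) [NormedAddCommGroup E] [NormedSpace ℝ E] [CompleteSpace E] (p : ℝ≥0∞)
    (β : ℝ≥0) : Prop :=
  ∀ (Ω : Type u) (_ : MeasurableSpace Ω) (μ : Measure Ω), SigmaFinite μ →
    ∀ (n : ℕ) (d : Fin n → Ω → E), IsMDS μ d → (∀ i, MemLp (d i) p μ) →
    ∀ ε : Fin n → ℤˣ,
      eLpNorm (fun ω => ∑ i, ε i • d i ω) p μ ≤ β * eLpNorm (fun ω => ∑ i, d i ω) p μ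

theorem memLp_units_smul {E Ω : Type*} [NormedAddCommGroup E] [NormedSpace ℝ E]
    [MeasurableSpace Ω] {p : ℝ≥0∞} {μ : Measure Ω} {f : Ω → E} (hf : MemLp f p μ) (e : ℤˣ) :
    MemLp (fun ω => e • f ω) p μ := by
  simp only [units_smul_eq_real_smul]
  exact hf.const_smul (((e : ℤ) : ℝ))

theorem ConstitutesMDS.units_smul {E : Type v} [NormedAddCommGroup E] [NormedSpace ℝ E]
    [CompleteSpace E] {Ω : Type u} [MeasurableSpace Ω] {μ : Measure Ω} {κ : Type*} {d : κ → Ω → E}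
    (hd : ConstitutesMDS μ d) (θ : κ → ℤˣ) :
    ConstitutesMDS μ fun k ω => θ k • d k ω := by
  obtain ⟨o, ℱ, hℱ, hm, hi, hc⟩ := hd
  have key : ∀ k, (fun ω => θ k • d k ω) = d k ∨ (fun ω => θ k • d k ω) = -d k := by
    intro k
    rcases Int.units_eq_one_or (θ k) with h | h
    · left; funext ω; simp [h]
    · right; funext ω; simp [h]
  refine ⟨o, ℱ, hℱ, fun k => ?_, fun k => ?_, fun i j hij => ?_⟩
  · rcases key k with h | h <;> beta_reduce <;> rw [h]
    exacts [hm k, (hm k).neg]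
  · rcases key k with h | h <;> beta_reduce <;> rw [h]
    exacts [hi k, (hi k).neg]
  · rcases key i with h | h <;> beta_reduce <;> rw [h]
    · exact hc i j hij
    · filter_upwards [condExp_neg (d i) (m := ℱ j) (μ := μ), hc i j hij] with ω h1 h2
      simp [h1, h2]

section UMD

variable {E : Type v} [NormedAddCommGroup E] [NormedSpace ℝ E] [CompleteSpace E] {p : ℝ≥0∞}
  {β : ℝ≥0} {Ω : Type u} [MeasurableSpace Ω] {μ : Measure Ω} [SigmaFinite μ]
  {κ : Type*} [Fintype κ] {d : κ → Ω → E}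

theorem IsUMDBound.eLpNorm_sum_units_smul_le (hβ : IsUMDBound.{u, v} E p β)
    (hd : ConstitutesMDS μ d) (hL : ∀ k, MemLp (d k) p μ) (θ : κ → ℤˣ) :
    eLpNorm (fun ω => ∑ k, θ k • d k ω) p μ ≤ β * eLpNorm (fun ω => ∑ k, d k ω) p μ := by
  obtain ⟨o, hd⟩ := hd
  let e := Fintype.orderIsoFinOfCardEq κ rfl
  have := hβ Ω _ μ inferInstance _ _ (hd.comp_strictMono e.strictMono) (fun i => hL (e i))
    fun i => θ (e i)
  have h1 : ∀ ω, ∑ i, θ (e i) • d (e i) ω = ∑ k, θ k • d k ω := fun ω =>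
    Fintype.sum_equiv e.toEquiv _ _ fun i => rfl
  have h2 : ∀ ω, ∑ i, d (e i) ω = ∑ k, d k ω := fun ω =>
    Fintype.sum_equiv e.toEquiv _ _ fun i => rfl
  simpa only [h1, h2] using this

/-- The signed family is again a martingale difference sequence, and applying the same signs twice
restores the original one. -/
theorem IsUMDBound.eLpNorm_sum_le_units_smul (hβ : IsUMDBound.{u, v} E p β)
    (hd : ConstitutesMDS μ d) (hL : ∀ k, MemLp (d k) p μ) (θ : κ → ℤˣ) :
    eLpNorm (fun ω => ∑ k, d k ω) p μ ≤ β * eLpNorm (fun ω => ∑ k, θ k • d k ω) p μ := by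
  have := hβ.eLpNorm_sum_units_smul_le (hd.units_smul θ) (fun k => memLp_units_smul (hL k) (θ k)) θ
  simpa only [smul_smul, ← sq, Int.units_sq, one_smul] using this

/-- The projection onto the indices in `t` is the mean of the identity and of the sign change that
is `1` on `t` and `-1` off `t`. The factor `1/2` is given away. -/
theorem IsUMDBound.eLpNorm_sum_finset_le (hp : 1 ≤ p) (hβ : IsUMDBound.{u, v} E p β)
    (hd : ConstitutesMDS μ d) (hL : ∀ k, MemLp (d k) p μ) (t : Finset κ) :
    eLpNorm (fun ω => ∑ k ∈ t, d k ω) p μ ≤ (1 + β) * eLpNorm (fun ω => ∑ k, d k ω) p μ := by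
  classical
  let θ : κ → ℤˣ := fun k => if k ∈ t then 1 else -1
  have h1 : (fun ω => ∑ k ∈ t, d k ω)
      = (2⁻¹ : ℝ) • ((fun ω => ∑ k, d k ω) + fun ω => ∑ k, θ k • d k ω) := by
    funext ω
    simp only [Pi.smul_apply, Pi.add_apply]
    rw [← Finset.sum_add_distrib, Finset.smul_sum, ← Finset.sum_filter_add_sum_filter_not
      (s := Finset.univ) (p := (· ∈ t))]
    rw [Finset.sum_eq_zero (s := Finset.univ.filter (¬ · ∈ t)), add_zero, Finset.filter_mem_eq_inter,
      Finset.univ_inter]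
    · refine Finset.sum_congr rfl fun k hk => ?_
      simp only [θ, hk, if_true, one_smul]
      rw [← two_smul ℝ, smul_smul]
      norm_num
    · intro k hk
      simp [θ, (Finset.mem_filter.1 hk).2]
  rw [h1]
  have hS : AEStronglyMeasurable (fun ω => ∑ k, d k ω) μ :=
    Finset.aestronglyMeasurable_fun_sum _ fun k _ => (hL k).1
  refine (eLpNorm_const_smul_le).trans ?_
  have h3 : ‖(2⁻¹ : ℝ)‖ₑ ≤ 1 := by
    rw [← ofReal_norm]
    norm_num
  refine (mul_le_mul' h3 le_rfl).trans ?_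
  rw [one_mul]
  refine (eLpNorm_add_le hS
    (aestronglyMeasurable_sum_units_smul (fun k => (hL k).1) θ) hp).trans ?_
  rw [add_mul, one_mul]
  gcongr
  exact hβ.eLpNorm_sum_units_smul_le hd hL θ

end UMD

/-! ### Randomization -/

/-- The disjoint union of copies of the measure `μ` over all choices of signs. -/
def signMeasure {X : Type*} [MeasurableSpace X] (ι : Type*) [Fintype ι] [DecidableEq ι]
    (μ : Measure X) : Measure (Σ _ : ι → ℤˣ, X) :=
  ∑ ε : ι → ℤˣ, μ.map (Sigma.mk ε)

section SignMeasure

variable {X : Type*} [mX : MeasurableSpace X] {ι : Type*}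

theorem measurableSet_sigma {α : Type*} {s : Set (Σ _ : α, X)} :
    MeasurableSet s ↔ ∀ a, MeasurableSet (Sigma.mk (β := fun _ => X) a ⁻¹' s) := by
  rw [Sigma.instMeasurableSpace, MeasurableSpace.measurableSet_iInf]
  rfl

theorem measurableEmbedding_sigmaMk {α : Type*} (a : α) :
    MeasurableEmbedding (Sigma.mk (β := fun _ => X) a) where
  injective := sigma_mk_injective
  measurable := fun s hs => measurableSet_sigma.1 hs a
  measurableSet_image' := by
    intro s hs
    refine measurableSet_sigma.2 fun b => ?_
    by_cases hab : a = b
    · subst hab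
      rwa [preimage_image_eq _ sigma_mk_injective]
    · convert MeasurableSet.empty
      ext x
      simp [hab]

variable [Fintype ι] [DecidableEq ι] {μ : Measure X} {E : Type*} [NormedAddCommGroup E]

theorem lintegral_signMeasure (f : (Σ _ : ι → ℤˣ, X) → ℝ≥0∞) :
    ∫⁻ z, f z ∂(signMeasure ι μ) = ∑ ε : ι → ℤˣ, ∫⁻ x, f ⟨ε, x⟩ ∂μ := by
  rw [signMeasure, lintegral_finsetSum_measure]
  exact Finset.sum_congr rfl fun ε _ => (measurableEmbedding_sigmaMk ε).lintegral_map _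

/-- Randomized norms become ordinary `L^p` norms on one measure space, to which the UMD property
applies. -/
theorem eLpNorm_signMeasure {p : ℝ≥0∞} (hp : 1 ≤ p) (hp' : p ≠ ∞) (f : (Σ _ : ι → ℤˣ, X) → E) :
    eLpNorm f p (signMeasure ι μ)
      = (∑ ε : ι → ℤˣ, eLpNorm (fun x => f ⟨ε, x⟩) p μ ^ p.toReal) ^ (1 / p.toReal) := by
  have h0 : p ≠ 0 := (zero_lt_one.trans_le hp).ne'
  have hq := toReal_pos_of_one_le hp hp'
  rw [eLpNorm_eq_lintegral_rpow_enorm_toReal h0 hp', lintegral_signMeasure]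
  congr 1
  refine Finset.sum_congr rfl fun ε _ => ?_
  rw [eLpNorm_eq_lintegral_rpow_enorm_toReal h0 hp', ← ENNReal.rpow_mul,
    one_div_mul_cancel hq.ne', ENNReal.rpow_one]

theorem aestronglyMeasurable_signMeasure {f : (Σ _ : ι → ℤˣ, X) → E}
    (hf : ∀ ε, AEStronglyMeasurable (fun x => f ⟨ε, x⟩) μ) :
    AEStronglyMeasurable f (signMeasure ι μ) := by
  rw [signMeasure, ← Measure.sum_fintype, aestronglyMeasurable_sum_measure_iff]
  exact fun ε => (measurableEmbedding_sigmaMk ε).aestronglyMeasurable_map_iff.2 (hf ε)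

theorem memLp_signMeasure {p : ℝ≥0∞} (hp : 1 ≤ p) (hp' : p ≠ ∞) {f : (Σ _ : ι → ℤˣ, X) → E}
    (hf : ∀ ε, MemLp (fun x => f ⟨ε, x⟩) p μ) : MemLp f p (signMeasure ι μ) := by
  refine ⟨aestronglyMeasurable_signMeasure fun ε => (hf ε).1, ?_⟩
  have hq := toReal_pos_of_one_le hp hp'
  rw [eLpNorm_signMeasure hp hp']
  refine ENNReal.rpow_lt_top_of_nonneg (by positivity) ?_
  refine (ENNReal.sum_lt_top.2 fun ε _ => ?_).ne
  exact ENNReal.rpow_lt_top_of_nonneg hq.le (hf ε).2.ne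

theorem setIntegral_signMeasure [NormedSpace ℝ E] {f : (Σ _ : ι → ℤˣ, X) → E}
    (hf : Integrable f (signMeasure ι μ)) {s : Set (Σ _ : ι → ℤˣ, X)} (hs : MeasurableSet s) :
    ∫ z in s, f z ∂(signMeasure ι μ)
      = ∑ ε : ι → ℤˣ, ∫ x in Sigma.mk (β := fun _ => X) ε ⁻¹' s, f ⟨ε, x⟩ ∂μ := by
  rw [← integral_indicator hs]
  have hf' := hf.indicator hs
  rw [signMeasure] at hf' ⊢
  rw [integral_finsetSum_measure fun ε _ =>
    hf'.mono_measure (Finset.single_le_sum (f := fun ε : ι → ℤˣ => μ.map (Sigma.mk ε))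
      (fun _ _ => Measure.zero_le _) (Finset.mem_univ ε))]
  refine Finset.sum_congr rfl fun ε _ => ?_
  rw [(measurableEmbedding_sigmaMk ε).integral_map, ← integral_indicator
    (measurableSet_sigma.1 hs ε)]
  rfl

theorem signMeasure_apply {s : Set (Σ _ : ι → ℤˣ, X)} :
    signMeasure ι μ s = ∑ ε : ι → ℤˣ, μ (Sigma.mk (β := fun _ => X) ε ⁻¹' s) := by
  simp only [signMeasure, Measure.coe_finsetSum, Finset.sum_apply]
  exact Finset.sum_congr rfl fun ε _ => (measurableEmbedding_sigmaMk ε).map_apply _ _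

end SignMeasure

/-! ### Stein's inequality -/

section Stein

/-- The sets all of whose slices belong to `m` and only depend on the signs in `I`. -/
@[reducible] def signAlgebra {X ι : Type*} (m : MeasurableSpace X) (I : Set ι) :
    MeasurableSpace (Σ _ : ι → ℤˣ, X) where
  MeasurableSet' s := (∀ ε, MeasurableSet[m] (Sigma.mk (β := fun _ => X) ε ⁻¹' s)) ∧
    ∀ ε ε' : ι → ℤˣ, (∀ i ∈ I, ε i = ε' i) →
      Sigma.mk (β := fun _ => X) ε ⁻¹' s = Sigma.mk (β := fun _ => X) ε' ⁻¹' s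
  measurableSet_empty := ⟨fun _ => by simp, fun _ _ _ => by simp⟩
  measurableSet_compl s hs := ⟨fun ε => by simpa using (hs.1 ε).compl, fun ε ε' h => by
    rw [preimage_compl, preimage_compl, hs.2 ε ε' h]⟩
  measurableSet_iUnion s hs := ⟨fun ε => by
    rw [preimage_iUnion]
    exact MeasurableSet.iUnion fun n => (hs n).1 ε, fun ε ε' h => by
    rw [preimage_iUnion, preimage_iUnion]
    exact iUnion_congr fun n => (hs n).2 ε ε' h⟩

variable {X : Type u} {ι : Type*}

theorem signAlgebra_mono {m₁ m₂ : MeasurableSpace X} (h : m₁ ≤ m₂) {I J : Set ι} (hIJ : I ⊆ J) :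
    signAlgebra m₁ I ≤ signAlgebra m₂ J :=
  fun _ hs => ⟨fun ε => h _ (hs.1 ε), fun ε ε' hε => hs.2 ε ε' fun i hi => hε i (hIJ hi)⟩

theorem signAlgebra_le {m : MeasurableSpace X} [mX : MeasurableSpace X] (h : m ≤ mX) (I : Set ι) :
    signAlgebra m I ≤ Sigma.instMeasurableSpace :=
  fun _ hs => measurableSet_sigma.2 fun ε => h _ (hs.1 ε)

theorem measurable_snd_signAlgebra {m : MeasurableSpace X} (I : Set ι) :
    Measurable[signAlgebra m I, m] (Sigma.snd : (Σ _ : ι → ℤˣ, X) → X) :=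
  fun _ hs => ⟨fun _ => hs, fun _ _ _ => rfl⟩

theorem measurable_sign_signAlgebra {m : MeasurableSpace X} {I : Set ι} {i : ι} (hi : i ∈ I) :
    Measurable[signAlgebra m I] fun z : Σ _ : ι → ℤˣ, X => (((z.1 i : ℤˣ) : ℤ) : ℝ) := by
  intro s _
  refine ⟨fun ε => ?_, fun ε ε' h => ?_⟩
  · by_cases hs : (((ε i : ℤˣ) : ℤ) : ℝ) ∈ s
    · convert @MeasurableSet.univ _ m
      ext x
      simp [hs]
    · convert @MeasurableSet.empty _ m
      ext x
      simp [hs]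
  · ext x
    simp [h i hi]

theorem stronglyMeasurable_sign_smul {E : Type*} [NormedAddCommGroup E] [NormedSpace ℝ E]
    {m : MeasurableSpace X} {I : Set ι} {i : ι} (hi : i ∈ I) {g : X → E}
    (hg : StronglyMeasurable[m] g) :
    StronglyMeasurable[signAlgebra m I] fun z : Σ _ : ι → ℤˣ, X => z.1 i • g z.2 := by
  simp only [units_smul_eq_real_smul]
  exact (measurable_sign_signAlgebra hi).stronglyMeasurable.smul
    (hg.comp_measurable (measurable_snd_signAlgebra I))

theorem sigmaFinite_signMeasure_trim [Fintype ι] [DecidableEq ι]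
    {m : MeasurableSpace X} [mX : MeasurableSpace X] {μ : Measure X} (h : m ≤ mX)
    [SigmaFinite (μ.trim h)] (I : Set ι) :
    SigmaFinite ((signMeasure ι μ).trim (signAlgebra_le h I)) := by
  refine ⟨⟨⟨fun n => {z | z.2 ∈ spanningSets (μ.trim h) n}, fun _ => trivial, fun n => ?_, ?_⟩⟩⟩
  · have hm : MeasurableSet[m] (spanningSets (μ.trim h) n) := measurableSet_spanningSets _ n
    have hm' : MeasurableSet[signAlgebra m I]
        {z : Σ _ : ι → ℤˣ, X | z.2 ∈ spanningSets (μ.trim h) n} := measurable_snd_signAlgebra I hm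
    rw [trim_measurableSet_eq _ hm', signMeasure_apply]
    refine ENNReal.sum_lt_top.2 fun ε _ => ?_
    have := measure_spanningSets_lt_top (μ.trim h) n
    rwa [trim_measurableSet_eq h hm] at this
  · ext z
    have := iUnion_spanningSets (μ.trim h)
    have hz : z.2 ∈ ⋃ n, spanningSets (μ.trim h) n := by rw [this]; trivial
    simpa only [mem_iUnion, mem_univ, iff_true, mem_ofPred_eq] using hz

/-- Flipping the `i`-th sign pairs the terms into cancelling couples. This yields the vanishing
conditional expectation of a term carrying a fresh sign. -/
theorem sum_signs_smul_eq_zero {E : Type*} [NormedAddCommGroup E] [NormedSpace ℝ E]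
    [Fintype ι] [DecidableEq ι] (i : ι) (w : (ι → ℤˣ) → E)
    (hw : ∀ ε ε' : ι → ℤˣ, (∀ j, j ≠ i → ε j = ε' j) → w ε = w ε') :
    ∑ ε : ι → ℤˣ, ε i • w ε = 0 := by
  refine Finset.sum_involution (fun ε _ => Function.update ε i (-ε i)) ?_ ?_ ?_ ?_
  · intro ε _
    rw [hw (Function.update ε i (-ε i)) ε fun j hj => by simp [hj]]
    simp [units_smul_eq_real_smul]
  · intro ε _ _ h
    have := congrFun h i
    rw [Function.update_self] at this
    rcases Int.units_eq_one_or (ε i) with h | h <;> rw [h] at this <;> revert this <;> decide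
  · simp
  · simp

variable [mX : MeasurableSpace X] {E : Type v} [NormedAddCommGroup E] [NormedSpace ℝ E]
  [CompleteSpace E]

/-- **Stein's inequality** for UMD spaces, due to Bourgain. -/
theorem IsUMDBound.signNorm_condExp_le {p : ℝ≥0∞} (hp : 1 ≤ p) (hp' : p ≠ ∞) {β : ℝ≥0}
    (hβ : IsUMDBound.{u, v} E p β) {μ : Measure X} [SigmaFinite μ] {n : ℕ}
    (ℱ : Filtration ℕ mX) [SigmaFiniteFiltration μ ℱ]
    {f : Fin n → X → E} (hf : ∀ i, MemLp (f i) p μ) (hfi : ∀ i, Integrable (f i) μ) :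
    signNorm p μ (fun i : Fin n => μ[f i | ℱ i]) ≤ (1 + β) * signNorm p μ f := by
  classical
  let G : ℕ → Fin n → X → E := fun i l => μ[f l | ℱ i]
  have hGm : ∀ i l, StronglyMeasurable[ℱ i] (G i l) := fun i l => stronglyMeasurable_condExp
  have hGL : ∀ i l, MemLp (G i l) p μ := fun i l => (hf l).condExp hp
  have hGi : ∀ i l, Integrable (G i l) μ := fun i l => integrable_condExp
  -- Each index contributes two differences: `(i, false)` introduces the new sign `i`, and `(i,
  -- true)` refines the σ-algebra from `ℱ i` to `ℱ (i + 1)` for the signs already present. All of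
  -- them add up to `∑ l, ε l • G n l`, while those with `false` add up to the randomized sum of the
  -- `G l l`. Stein's inequality is thus the boundedness of a projection onto a subfamily.
  let d : Fin n × Bool → (Σ _ : Fin n → ℤˣ, X) → E := fun k z =>
    if k.2 then ∑ l : Fin n, (if l ≤ k.1 then z.1 l • (G (k.1 + 1) l z.2 - G k.1 l z.2) else 0)
    else z.1 k.1 • G k.1 k.1 z.2
  -- Used for `q = p` and for `q = 1`: on an infinite measure space, integrability does not follow
  -- from membership in `L^p`.
  have hslice : ∀ {q : ℝ≥0∞}, (∀ i l, MemLp (G i l) q μ) →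
      ∀ k (ε : Fin n → ℤˣ), MemLp (fun x => d k ⟨ε, x⟩) q μ := by
    rintro q hq ⟨i, b⟩ ε
    cases b
    · exact memLp_units_smul (hq i i) (ε i)
    · refine memLp_finsetSum _ fun l _ => ?_
      by_cases hl : l ≤ i
      · simpa [hl] using memLp_units_smul ((hq (i + 1) l).sub (hq i l)) (ε l)
      · simp [hl]
  have hdL : ∀ k, MemLp (d k) p (signMeasure (Fin n) μ) := fun k =>
    memLp_signMeasure hp hp' (hslice hGL k)
  have hdi : ∀ k, Integrable (d k) (signMeasure (Fin n) μ) := fun k =>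
    memLp_one_iff_integrable.1 (memLp_signMeasure le_rfl ENNReal.one_ne_top
      (hslice (fun i l => memLp_one_iff_integrable.2 (hGi i l)) k))
  let lev : Fin n × Bool → ℕ := fun k => if k.2 then k.1 + 1 else k.1
  have hsf : ∀ (i : ℕ) (I : Set (Fin n)),
      SigmaFinite ((signMeasure (Fin n) μ).trim (signAlgebra_le (ℱ.le i) I)) :=
    fun i I => sigmaFinite_signMeasure_trim (ℱ.le i) I
  have hsfμ : SigmaFinite (signMeasure (Fin n) μ) :=
    have := hsf 0 univ
    SigmaFinite.of_trim (signAlgebra_le (ℱ.le 0) univ)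
  have hmds : ConstitutesMDS (signMeasure (Fin n) μ) d := by
    -- In the lexicographic order `(i, false)` comes just before `(i, true)`.
    suffices h : ConstitutesMDS (signMeasure (Fin n) μ) fun k : Fin n ×ₗ Bool => d (ofLex k) from
      h.comp_injective (e := toLex) toLex.injective
    have hlt : ∀ {a b : Fin n ×ₗ Bool}, a < b → (ofLex a).1 < (ofLex b).1 ∨
        (ofLex a).1 = (ofLex b).1 ∧ (ofLex a).2 = false ∧ (ofLex b).2 = true := by
      intro a b hab
      rcases (Prod.Lex.lt_iff.1 hab) with h | h
      · exact Or.inl h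
      · refine Or.inr ⟨h.1, ?_⟩
        have := h.2
        revert this
        cases (ofLex a).2 <;> cases (ofLex b).2 <;> decide
    refine ⟨inferInstance, ⟨fun k => signAlgebra (ℱ (lev (ofLex k))) {l | l ≤ (ofLex k).1}, ?_,
      fun k => signAlgebra_le (ℱ.le _) _⟩, ⟨fun k => hsf _ _⟩, ?_, fun k => hdi (ofLex k), ?_⟩
    · intro a b hab
      rcases hab.eq_or_lt with h | h
      · rw [h]
      · rcases hlt h with h | ⟨h1, h2, h3⟩
        · refine signAlgebra_mono (ℱ.mono ?_) fun l hl => le_trans hl h.le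
          simp only [lev]
          have : ((ofLex a).1 : ℕ) < (ofLex b).1 := h
          split_ifs <;> omega
        · refine signAlgebra_mono (ℱ.mono ?_) fun l hl => le_trans hl h1.le
          simp [lev, h1, h2, h3]
    · rintro ⟨i, b⟩
      cases b
      · exact stronglyMeasurable_sign_smul (m := ℱ i) (I := {l | l ≤ i}) (i := i)
          (show i ≤ i from le_rfl) (hGm i i)
      · refine Finset.stronglyMeasurable_fun_sum _ fun l _ => ?_
        change StronglyMeasurable[signAlgebra (ℱ (i + 1)) {l | l ≤ i}]
          fun z : Σ _ : Fin n → ℤˣ, X =>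
            if l ≤ i then z.1 l • (G (i + 1) l z.2 - G i l z.2) else 0
        by_cases hl : l ≤ i
        · simp only [hl, if_true]
          exact stronglyMeasurable_sign_smul (m := ℱ (i + 1)) (I := {l | l ≤ i}) (i := l) hl
            ((hGm (i + 1) l).sub ((hGm i l).mono (ℱ.mono i.1.le_succ)))
        · simp only [hl, if_false]
          exact stronglyMeasurable_const
    · intro a b hba
      obtain ⟨b, rfl⟩ := toLex.surjective b
      obtain ⟨a, rfl⟩ := toLex.surjective a
      have := hsf (lev b) {l | l ≤ b.1}
      refine (ae_eq_condExp_of_forall_setIntegral_eq (signAlgebra_le (ℱ.le _) _) (hdi a)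
        (fun s _ _ => (integrable_zero _ _ _).integrableOn) (fun s hs _ => ?_)
        stronglyMeasurable_zero.aestronglyMeasurable).symm
      have hs' := signAlgebra_le (ℱ.le _) _ s hs
      rw [setIntegral_signMeasure (hdi a) hs']
      obtain ⟨i, c⟩ := a
      cases c
      -- Membership in an earlier set depends only on the signs up to `b.1 < i`, so summation over
      -- the sign `i` cancels the integrals.
      · have hb : b.1 < i := by
          rcases hlt hba with h | h
          · exact h
          · simpa using h.2.2
        have : ∀ ε : Fin n → ℤˣ,
            ∫ x in Sigma.mk (β := fun _ => X) ε ⁻¹' s, d (i, false) ⟨ε, x⟩ ∂μ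
            = ε i • ∫ x in Sigma.mk (β := fun _ => X) ε ⁻¹' s, G i i x ∂μ := by
          intro ε
          simp only [d, units_smul_eq_real_smul]
          exact integral_smul _ _
        simp only [this]
        rw [sum_signs_smul_eq_zero i]
        · simp
        · intro ε ε' h
          rw [hs.2 ε ε' fun j hj => h j (ne_of_lt (lt_of_le_of_lt hj hb))]
      -- The slices of an earlier set belong to `ℱ i`, and over such a slice `G (i + 1) l` and `G i
      -- l` both have the integral of `f l`.
      · have hb : lev b ≤ i := by
          rcases hlt hba with h | h
          · have : (b.1 : ℕ) < i := h
            simp only [lev]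
            split_ifs <;> omega
          · obtain ⟨h1, h2, -⟩ := h
            have h1 : b.1 = i := h1
            have h2 : b.2 = false := h2
            simp [lev, h1, h2]
        rw [Finset.sum_eq_zero]
        · simp
        intro ε _
        have hse := hs.1 ε
        simp only [d, if_true]
        rw [integral_finsetSum _ fun l _ => ?_]
        · refine Finset.sum_eq_zero fun l _ => ?_
          by_cases hl : l ≤ i
          · simp only [hl, if_true, units_smul_eq_real_smul]
            rw [integral_smul, integral_sub (hGi _ _).integrableOn (hGi _ _).integrableOn,
              setIntegral_condExp (ℱ.le _) (hfi l) (ℱ.mono hb _ hse),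
              setIntegral_condExp (ℱ.le _) (hfi l) (ℱ.mono (hb.trans i.1.le_succ) _ hse)]
            simp
          · simp [hl]
        · by_cases hl : l ≤ i
          · simp only [hl, if_true, units_smul_eq_real_smul]
            exact (((hGi _ _).sub (hGi _ _)).smul _).integrableOn
          · simp [hl]
  have hsum : ∀ z, ∑ k, d k z = ∑ l, z.1 l • G n l z.2 := by
    intro z
    have htel : ∀ (l : Fin n) (m : ℕ), l ≤ m → ∑ i ∈ Finset.range m,
        (if l ≤ i then z.1 l • (G (i + 1) l z.2 - G i l z.2) else 0)
        = z.1 l • G m l z.2 - z.1 l • G l l z.2 := by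
      intro l m hm
      induction m, hm using Nat.le_induction with
      | base =>
        rw [sub_self]
        refine Finset.sum_eq_zero fun i hi => ?_
        rw [if_neg (not_le.2 (Finset.mem_range.1 hi))]
      | succ m hm ih =>
        rw [Finset.sum_range_succ, ih, if_pos hm, smul_sub]
        abel
    rw [Fintype.sum_prod_type]
    simp only [Fintype.sum_bool, d, if_true, Bool.false_eq_true, if_false]
    rw [Finset.sum_add_distrib, Finset.sum_comm, ← Finset.sum_add_distrib]
    refine Finset.sum_congr rfl fun l _ => ?_
    have := htel l n l.2.le
    rw [Finset.sum_range] at this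
    simp only [Fin.val_fin_le] at this
    rw [this]
    abel
  have heven : ∀ z, ∑ k ∈ Finset.univ.filter (fun k : Fin n × Bool => k.2 = false), d k z
      = ∑ l, z.1 l • G l l z.2 := by
    intro z
    rw [Finset.sum_filter, Fintype.sum_prod_type]
    simp [d]
  have hmain := hβ.eLpNorm_sum_finset_le hp hmds hdL
    (Finset.univ.filter fun k : Fin n × Bool => k.2 = false)
  simp only [heven, hsum] at hmain
  rw [eLpNorm_signMeasure hp hp', eLpNorm_signMeasure hp hp'] at hmain
  refine hmain.trans ?_
  gcongr
  -- For fixed signs, the full sum is the conditional expectation of `∑ l, ε l • f l` given `ℱ n`,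
  -- and conditional expectation is a contraction on `L^p`.
  have hlast := sum_rpow_le_of_le (toReal_pos_of_one_le hp hp') (C := 1)
    (u := fun ε : Fin n → ℤˣ => eLpNorm (fun x => ∑ l, ε l • G n l x) p μ)
    (w := fun ε : Fin n → ℤˣ => eLpNorm (fun x => ∑ l, ε l • f l x) p μ) ?_
  · simpa [signNorm] using hlast
  intro ε
  rw [one_mul]
  refine le_trans (le_of_eq (eLpNorm_congr_ae ?_))
    (eLpNorm_condExp_le_eLpNorm (m := ℱ n) (fun x => ∑ l, ε l • f l x) hp)
  have h1 : (fun x => ∑ l, ε l • f l x) = ∑ l, ((((ε l : ℤˣ) : ℤ) : ℝ) • f l) := by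
    funext x
    simp [units_smul_eq_real_smul]
  rw [h1]
  have h2 := condExp_finsetSum (μ := μ) (s := Finset.univ)
    (f := fun l => ((((ε l : ℤˣ) : ℤ) : ℝ) • f l)) (fun l _ => (hfi l).smul _) (ℱ n)
  have h3 : ∀ᵐ x ∂μ, ∀ l, μ[((((ε l : ℤˣ) : ℤ) : ℝ) • f l) | ℱ n] x
      = (((ε l : ℤˣ) : ℤ) : ℝ) • G n l x := ae_all_iff.2 fun l => condExp_smul _ _ _
  filter_upwards [h2, h3] with x hx hx'
  rw [hx, Finset.sum_apply]
  exact Finset.sum_congr rfl fun l _ => by rw [hx', units_smul_eq_real_smul]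

end Stein

/-! ### Averages over nested families of sets -/

/-- A family of sets is nested if any two of its members are comparable or disjoint. -/
def NestedFamily {X κ : Type*} (U : κ → Set X) : Prop :=
  ∀ i j, U i ⊆ U j ∨ U j ⊆ U i ∨ Disjoint (U i) (U j)

/-- The sets are sorted by the number of members that strictly contain them; a strictly larger set
has a smaller count, so it never comes later. -/
theorem NestedFamily.exists_equiv_fin {X κ : Type*} [Fintype κ] {U : κ → Set X}
    (hU : NestedFamily U) : ∃ e : Fin (Fintype.card κ) ≃ κ,
      ∀ i j, i ≤ j → U (e j) ⊆ U (e i) ∨ Disjoint (U (e j)) (U (e i)) := by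
  classical
  let depth : κ → ℕ := fun i => (Finset.univ.filter fun l => U i ⊂ U l).card
  have hdepth : ∀ i j, U i ⊂ U j → depth j < depth i := by
    intro i j hij
    refine Finset.card_lt_card ⟨fun l hl => ?_, fun h => ?_⟩
    · simp only [Finset.mem_filter, Finset.mem_univ, true_and] at hl ⊢
      exact hij.trans hl
    · have := h (Finset.mem_filter.2 ⟨Finset.mem_univ j, hij⟩)
      simp at this
  let e₀ := (Fintype.equivFin κ).symm
  let σ := Tuple.sort (depth ∘ e₀)
  have hmono : Monotone ((depth ∘ e₀) ∘ σ) := Tuple.monotone_sort (depth ∘ e₀)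
  refine ⟨σ.trans e₀, fun i j hij => ?_⟩
  have h1 : depth (e₀ (σ i)) ≤ depth (e₀ (σ j)) := hmono hij
  simp only [Equiv.trans_apply]
  rcases hU (e₀ (σ i)) (e₀ (σ j)) with h | h | h
  · left
    by_contra h'
    exact absurd (hdepth _ _ ⟨h, h'⟩) (not_lt.2 h1)
  · exact Or.inl h
  · exact Or.inr h.symm

section Nested

variable {X : Type u} [mX : MeasurableSpace X]

/-- The measurable sets which do not cut any of the sets `U l` with `i ≤ l`. -/
@[reducible] def uncutAlgebra {n : ℕ} (U : Fin n → Set X) (i : ℕ) : MeasurableSpace X where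
  MeasurableSet' s := MeasurableSet s ∧ ∀ l : Fin n, i ≤ l → U l ⊆ s ∨ Disjoint (U l) s
  measurableSet_empty := ⟨MeasurableSet.empty, fun _ _ => Or.inr (by simp)⟩
  measurableSet_compl s hs := ⟨hs.1.compl, fun l hl => by
    rcases hs.2 l hl with h | h
    · exact Or.inr (disjoint_compl_right_iff_subset.2 h)
    · exact Or.inl (subset_compl_iff_disjoint_right.2 h)⟩
  measurableSet_iUnion s hs := ⟨MeasurableSet.iUnion fun n => (hs n).1, fun l hl => by
    by_cases h : ∃ n, U l ⊆ s n
    · obtain ⟨n, hn⟩ := h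
      exact Or.inl (hn.trans (subset_iUnion _ _))
    · push Not at h
      exact Or.inr (disjoint_iUnion_right.2 fun n => ((hs n).2 l hl).resolve_left (h n))⟩

/-- The filtration of the algebras `uncutAlgebra U i`. -/
def uncutFiltration {n : ℕ} (U : Fin n → Set X) : Filtration ℕ mX where
  seq i := uncutAlgebra U i
  mono' _ _ hij _ hs := ⟨hs.1, fun l hl => hs.2 l (hij.trans hl)⟩
  le' _ _ hs := hs.1

/-- An exhausting sequence must not cut any `U l`, so the whole union of the `U l`, which has finite
measure, is added to each of its sets. -/
theorem sigmaFinite_uncutFiltration {n : ℕ} {U : Fin n → Set X} {μ : Measure X} [SigmaFinite μ]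
    (hU : ∀ i, MeasurableSet (U i)) (hfin : ∀ i, μ (U i) ≠ ∞) :
    SigmaFiniteFiltration μ (uncutFiltration U) := by
  refine ⟨fun i => ⟨⟨⟨fun N => spanningSets μ N \ (⋃ l, U l) ∪ ⋃ l, U l, fun _ => trivial,
    fun N => ?_, ?_⟩⟩⟩⟩
  · have hm : MeasurableSet[uncutFiltration U i] (spanningSets μ N \ (⋃ l, U l) ∪ ⋃ l, U l) := by
      refine ⟨?_, fun l _ => Or.inl ?_⟩
      · have := MeasurableSet.iUnion hU
        exact ((measurableSet_spanningSets μ N).diff this).union this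
      · exact (subset_iUnion U l).trans subset_union_right
    rw [trim_measurableSet_eq _ hm]
    refine (measure_union_le _ _).trans_lt (ENNReal.add_lt_top.2 ⟨?_, ?_⟩)
    · exact (measure_mono sdiff_subset).trans_lt (measure_spanningSets_lt_top μ N)
    · refine (measure_iUnion_le _).trans_lt ?_
      rw [tsum_fintype]
      exact ENNReal.sum_lt_top.2 fun l _ => (hfin l).lt_top
  · refine eq_univ_of_forall fun x => ?_
    have hx : x ∈ ⋃ N, spanningSets μ N := by rw [iUnion_spanningSets]; trivial
    obtain ⟨N, hN⟩ := mem_iUnion.1 hx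
    exact mem_iUnion.2 ⟨N, by rw [sdiff_union_self]; exact Or.inl hN⟩

variable {E : Type v} [NormedAddCommGroup E] {μ : Measure X}

theorem integrable_of_memLp_of_eq_zero {p : ℝ≥0∞} (hp : 1 ≤ p) {f : X → E} (hf : MemLp f p μ)
    {U : Set X} (hfin : μ U ≠ ∞) (hsupp : ∀ᵐ x ∂μ, x ∉ U → f x = 0) : Integrable f μ := by
  have : IsFiniteMeasure (μ.restrict U) := isFiniteMeasure_restrict.2 hfin
  have h1 : IntegrableOn f U μ := (hf.restrict U).integrable hp
  exact h1.integrable_of_ae_notMem_eq_zero hsupp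

/-- `U i` is an atom of the `i`-th algebra: it belongs to the algebra because no later set is cut by
it, and every member of the algebra contains it or misses it. Conditioning a function supported in
`U i` therefore averages it. -/
theorem condExp_uncutFiltration [NormedSpace ℝ E] [CompleteSpace E] [SigmaFinite μ] {n : ℕ}
    {U : Fin n → Set X} (hU : ∀ i, MeasurableSet (U i)) (hfin : ∀ i, μ (U i) ≠ ∞)
    (hnest : ∀ i j, i ≤ j → U j ⊆ U i ∨ Disjoint (U j) (U i)) (i : Fin n) {f : X → E}
    (hf : Integrable f μ) (hsupp : ∀ᵐ x ∂μ, x ∉ U i → f x = 0) :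
    (U i).indicator (fun _ => ⨍ x in U i, f x ∂μ) =ᵐ[μ] μ[f | uncutFiltration U i] := by
  have := sigmaFinite_uncutFiltration hU hfin
  have hfU : f =ᵐ[μ] (U i).indicator f := by
    filter_upwards [hsupp] with x hx
    by_cases h : x ∈ U i
    · rw [indicator_of_mem h]
    · rw [indicator_of_notMem h, hx h]
  have hUm : MeasurableSet[uncutFiltration U i] (U i) := ⟨hU i, fun l hl => hnest i l hl⟩
  refine ae_eq_condExp_of_forall_setIntegral_eq ((uncutFiltration U).le i) hf
    (fun s _ _ => ?_) (fun s hs _ => ?_) ?_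
  · exact ((integrable_indicator_iff (hU i)).2 (integrableOn_const (hfin i))).integrableOn
  · rw [setIntegral_congr_ae (g := (U i).indicator f) hs.1 (hfU.mono fun x hx _ => hx),
      setIntegral_indicator (hU i), setIntegral_indicator (hU i)]
    rcases hs.2 i le_rfl with h | h
    · rw [inter_eq_self_of_subset_right h, setIntegral_const, measure_smul_setAverage _ (hfin i)]
    · rw [inter_comm, h.inter_eq]
      simp
  · exact (stronglyMeasurable_const.indicator hUm).aestronglyMeasurable

/-- Stein's inequality for averages over a nested family of sets. -/
theorem IsUMDBound.signNorm_average_le [NormedSpace ℝ E] [CompleteSpace E] {p : ℝ≥0∞} (hp : 1 ≤ p)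
    (hp' : p ≠ ∞) {β : ℝ≥0} (hβ : IsUMDBound.{u, v} E p β) [SigmaFinite μ] {κ : Type*} [Fintype κ]
    [DecidableEq κ] {U : κ → Set X} (hU : ∀ i, MeasurableSet (U i)) (hfin : ∀ i, μ (U i) ≠ ∞)
    (hnest : NestedFamily U) {f : κ → X → E} (hf : ∀ i, MemLp (f i) p μ)
    (hsupp : ∀ i, ∀ᵐ x ∂μ, x ∉ U i → f i x = 0) :
    signNorm p μ (fun i => (U i).indicator fun _ => ⨍ x in U i, f i x ∂μ)
      ≤ (1 + β) * signNorm p μ f := by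
  obtain ⟨e, he⟩ := hnest.exists_equiv_fin
  have hfi : ∀ i, Integrable (f i) μ := fun i =>
    integrable_of_memLp_of_eq_zero hp (hf i) (hfin i) (hsupp i)
  have := sigmaFinite_uncutFiltration (U := fun i => U (e i)) (fun i => hU (e i))
    (fun i => hfin (e i))
  have h := hβ.signNorm_condExp_le hp hp' (uncutFiltration fun i => U (e i))
    (f := fun i => f (e i)) (fun i => hf (e i)) (fun i => hfi (e i))
  rw [signNorm_reindex e f] at h
  rw [← signNorm_reindex e]
  refine le_trans (le_of_eq (signNorm_congr fun i => ?_)) h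
  exact condExp_uncutFiltration (U := fun i => U (e i)) (fun i => hU (e i))
    (fun i => hfin (e i)) he i (hfi (e i)) (hsupp (e i))

section Scalar

variable [NormedSpace ℝ E] {𝕜 : Type*} [RCLike 𝕜] [NormedSpace 𝕜 E] [IsScalarTower ℝ 𝕜 E]
  {p : ℝ≥0∞} {κ : Type*} [Fintype κ] [DecidableEq κ]

theorem signNorm_smul_le_of_norm_le (hp : 1 ≤ p) (hp' : p ≠ ∞) {ψ φ : κ → X → 𝕜} (a : κ → E)
    (hψ : ∀ k, AEStronglyMeasurable (ψ k) μ) (hφ : ∀ k, AEStronglyMeasurable (φ k) μ)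
    (h : ∀ k, ∀ᵐ x ∂μ, ‖ψ k x‖ ≤ ‖φ k x‖) :
    signNorm p μ (fun k x => ψ k x • a k) ≤ 2 * signNorm p μ (fun k x => φ k x • a k) := by
  refine signNorm_le_of_smul (𝕜 := 𝕜) hp hp' (fun k => (hψ k).smul_const (a k))
    (fun k => (hφ k).smul_const (a k)) fun k => ?_
  filter_upwards [h k] with x hx
  by_cases h0 : φ k x = 0
  · refine ⟨0, by simp, ?_⟩
    rw [h0, norm_zero] at hx
    rw [norm_le_zero_iff.1 hx]
    simp
  · refine ⟨ψ k x / φ k x, ?_, ?_⟩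
    · rw [norm_div]
      exact div_le_one_of_le₀ hx (norm_nonneg _)
    · rw [smul_smul, div_mul_cancel₀ _ h0]

theorem signNorm_const_smul_le (hp : 1 ≤ p) (hp' : p ≠ ∞) (K : ℝ≥0) (f : κ → X → E) :
    signNorm p μ (fun k x => (K : ℝ) • f k x) ≤ K * signNorm p μ f := by
  refine sum_rpow_le_of_le (toReal_pos_of_one_le hp hp') fun ε => ?_
  have : (fun x => ∑ k, ε k • (K : ℝ) • f k x) = (K : ℝ) • fun x => ∑ k, ε k • f k x := by
    funext x
    simp only [Pi.smul_apply, Finset.smul_sum]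
    exact Finset.sum_congr rfl fun k _ => units_smul_comm_smul _ _ _
  rw [this]
  refine eLpNorm_const_smul_le.trans (le_of_eq ?_)
  congr 1
  rw [← ofReal_norm, Real.norm_of_nonneg K.coe_nonneg, ENNReal.ofReal_coe_nnreal]

theorem ofReal_setAverage_norm {φ : X → 𝕜} (hφ : Integrable φ μ) {U : Set X}
    (h0 : μ U ≠ 0) (hfin : μ U ≠ ∞)
    (hsupp : ∀ᵐ x ∂μ, x ∉ U → φ x = 0) :
    ENNReal.ofReal (⨍ x in U, ‖φ x‖ ∂μ) = (μ U)⁻¹ * ∫⁻ x, ‖φ x‖ₑ ∂μ := by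
  rw [setAverage_eq, smul_eq_mul, ENNReal.ofReal_mul (by positivity)]
  congr 1
  · rw [measureReal_def, ENNReal.ofReal_inv_of_pos (ENNReal.toReal_pos h0 hfin),
      ENNReal.ofReal_toReal hfin]
  · rw [setIntegral_eq_integral_of_ae_compl_eq_zero, ofReal_integral_norm_eq_lintegral_enorm hφ]
    filter_upwards [hsupp] with x hx h
    rw [hx h, norm_zero]

/-- Replacing functions by functions that are dominated by averages over a nested family of
supports. -/
theorem IsUMDBound.signNorm_smul_le_of_average [CompleteSpace E] (hp : 1 ≤ p) (hp' : p ≠ ∞)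
    {β : ℝ≥0} (hβ : IsUMDBound.{u, v} E p β) [SigmaFinite μ] {U : κ → Set X}
    (hU : ∀ k, MeasurableSet (U k)) (h0 : ∀ k, μ (U k) ≠ 0) (hfin : ∀ k, μ (U k) ≠ ∞)
    (hnest : NestedFamily U) {ψ φ : κ → X → 𝕜} (hψ : ∀ k, AEStronglyMeasurable (ψ k) μ)
    (hφ : ∀ k, MemLp (φ k) p μ)
    (hψU : ∀ k, ∀ᵐ x ∂μ, x ∉ U k → ψ k x = 0) (hφU : ∀ k, ∀ᵐ x ∂μ, x ∉ U k → φ k x = 0)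
    (K : ℝ≥0) (hK : ∀ k, eLpNorm (ψ k) ∞ μ ≤ K * ((μ (U k))⁻¹ * ∫⁻ x, ‖φ k x‖ₑ ∂μ)) (a : κ → E) :
    signNorm p μ (fun k x => ψ k x • a k)
      ≤ 4 * (1 + β) * K * signNorm p μ (fun k x => φ k x • a k) := by
  -- The contraction principle replaces `ψ k` by the constant `K * b k` on `U k`, Stein's inequality
  -- replaces the average by `‖φ k‖`, and a second contraction removes the modulus. The two
  -- contractions account for the factor 4.
  let b : κ → ℝ := fun k => ⨍ x in U k, ‖φ k x‖ ∂μ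
  have hb : ∀ k, 0 ≤ b k := fun k => by
    simp only [b, setAverage_eq]
    positivity
  have hφi : ∀ k, Integrable (φ k) μ := fun k =>
    integrable_of_memLp_of_eq_zero hp (hφ k) (hfin k) (hφU k)
  let w : κ → X → 𝕜 := fun k => (U k).indicator fun _ => ((K * b k : ℝ) : 𝕜)
  have hw : ∀ k, AEStronglyMeasurable (w k) μ := fun k =>
    aestronglyMeasurable_const.indicator (hU k)
  have hstep1 := signNorm_smul_le_of_norm_le (p := p) (μ := μ) hp hp' a hψ hw (fun k => by
    filter_upwards [hψU k, enorm_ae_le_eLpNormEssSup (ψ k) μ] with x hx hx'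
    by_cases hxU : x ∈ U k
    · simp only [w, indicator_of_mem hxU]
      rw [← eLpNorm_exponent_top] at hx'
      have h1 := hx'.trans (hK k)
      rw [← ofReal_setAverage_norm (hφi k) (h0 k) (hfin k) (hφU k),
        ← ENNReal.ofReal_coe_nnreal, ← ENNReal.ofReal_mul K.coe_nonneg, ← ofReal_norm,
        ENNReal.ofReal_le_ofReal_iff (mul_nonneg K.coe_nonneg (hb k))] at h1
      rw [RCLike.norm_ofReal, abs_of_nonneg (mul_nonneg K.coe_nonneg (hb k))]
      exact h1
    · rw [hx hxU, norm_zero]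
      exact norm_nonneg _)
  have hφn : ∀ k, MemLp (fun x => ‖φ k x‖ • a k) p μ := fun k =>
    memLp_smul_vec (𝕜 := ℝ) E (hφ k).norm (a k)
  have hstep2 : signNorm p μ (fun k x => w k x • a k) ≤ K * signNorm p μ
      (fun k => (U k).indicator fun _ => ⨍ x in U k, ‖φ k x‖ • a k ∂μ) := by
    refine le_trans (le_of_eq ?_) (signNorm_const_smul_le hp hp' K _)
    congr 1
    funext k x
    by_cases hxU : x ∈ U k
    · simp only [w, indicator_of_mem hxU]
      rw [← RCLike.real_smul_eq_coe_smul, mul_smul]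
      congr 1
      simp only [b, setAverage_eq, integral_smul_const, smul_assoc]
    · simp only [w, indicator_of_notMem hxU, zero_smul, smul_zero]
  have hstep3 := hβ.signNorm_average_le hp hp' hU hfin hnest hφn fun k => by
    filter_upwards [hφU k] with x hx h
    rw [hx h, norm_zero, zero_smul]
  have hstep4 : signNorm p μ (fun k x => ‖φ k x‖ • a k)
      ≤ 2 * signNorm p μ (fun k x => φ k x • a k) := by
    have := signNorm_smul_le_of_norm_le (p := p) (μ := μ) hp hp' a
      (ψ := fun k x => ((‖φ k x‖ : ℝ) : 𝕜)) (φ := φ)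
      (fun k => RCLike.continuous_ofReal.comp_aestronglyMeasurable (hφ k).1.norm)
      (fun k => (hφ k).1) (fun k => by simp)
    simpa only [← RCLike.real_smul_eq_coe_smul] using this
  calc _ ≤ 2 * (K * ((1 + β) * (2 * signNorm p μ (fun k x => φ k x • a k)))) :=
        hstep1.trans (mul_le_mul' le_rfl (hstep2.trans (mul_le_mul' le_rfl
          (hstep3.trans (mul_le_mul' le_rfl hstep4)))))
    _ = _ := by ring

end Scalar

end Nested

/-! ### Martingale differences with comparable averages -/

/-- Changes of signs affect the norm of the sum of the functions `d k` by a factor `β` at most. -/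
def SignUnconditional {X E κ : Type*} [MeasurableSpace X] [NormedAddCommGroup E] [Fintype κ]
    (p : ℝ≥0∞) (μ : Measure X) (β : ℝ≥0) (d : κ → X → E) : Prop :=
  ∀ ε : κ → ℤˣ,
    eLpNorm (fun x => ∑ k, ε k • d k x) p μ ≤ β * eLpNorm (fun x => ∑ k, d k x) p μ ∧
    eLpNorm (fun x => ∑ k, d k x) p μ ≤ β * eLpNorm (fun x => ∑ k, ε k • d k x) p μ

theorem IsUMDBound.signUnconditional {X : Type u} [MeasurableSpace X] {μ : Measure X}
    [SigmaFinite μ] {E : Type v} [NormedAddCommGroup E] [NormedSpace ℝ E] [CompleteSpace E]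
    {p : ℝ≥0∞} {β : ℝ≥0} {κ : Type*} [Fintype κ] (hβ : IsUMDBound.{u, v} E p β)
    {d : κ → X → E} (hd : ConstitutesMDS μ d) (hL : ∀ k, MemLp (d k) p μ) :
    SignUnconditional p μ β d := fun ε =>
  ⟨hβ.eLpNorm_sum_units_smul_le hd hL ε, hβ.eLpNorm_sum_le_units_smul hd hL ε⟩

/-- For unconditional sequences, inequalities between randomized norms imply inequalities
between the norms of the sums. -/
theorem eLpNorm_sum_le_of_signNorm_le {X E κ : Type*} [MeasurableSpace X] {μ : Measure X}
    [NormedAddCommGroup E] [Fintype κ] [DecidableEq κ] {p : ℝ≥0∞} (hp : 1 ≤ p) (hp' : p ≠ ∞)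
    {β : ℝ≥0} {d d' : κ → X → E} (hd : SignUnconditional p μ β d) (hd' : SignUnconditional p μ β d')
    {K : ℝ≥0∞} (h : signNorm p μ d ≤ K * signNorm p μ d') :
    eLpNorm (fun x => ∑ k, d k x) p μ ≤ β ^ 2 * K * eLpNorm (fun x => ∑ k, d' k x) p μ := by
  have hq := toReal_pos_of_one_le hp hp'
  -- The signs carry the counting measure, so passing from a plain to a randomized norm introduces
  -- this factor; it occurs on both sides and cancels.
  let c : ℝ≥0∞ := (Fintype.card (κ → ℤˣ) : ℝ≥0∞) ^ (1 / p.toReal)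
  have hcard : (Fintype.card (κ → ℤˣ) : ℝ≥0∞) ≠ 0 := by
    exact_mod_cast Fintype.card_ne_zero
  have hc0 : c ≠ 0 := by
    simp only [c, ne_eq, ENNReal.rpow_eq_zero_iff, hcard, false_and, false_or, not_and, not_lt]
    exact fun _ => by positivity
  have hct : c ≠ ∞ := ENNReal.rpow_ne_top_of_nonneg (by positivity) (ENNReal.natCast_ne_top _)
  have hconst : ∀ t : ℝ≥0∞, (∑ _ε : κ → ℤˣ, t ^ p.toReal) ^ (1 / p.toReal) = c * t := by
    intro t
    rw [Finset.sum_const, Finset.card_univ, nsmul_eq_mul,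
      ENNReal.mul_rpow_of_nonneg _ _ (by positivity), ← ENNReal.rpow_mul,
      mul_one_div_cancel hq.ne', ENNReal.rpow_one]
  have h1 : c * eLpNorm (fun x => ∑ k, d k x) p μ ≤ β * signNorm p μ d := by
    rw [← hconst]
    exact sum_rpow_le_of_le hq fun ε => (hd ε).2
  have h2 : signNorm p μ d' ≤ β * (c * eLpNorm (fun x => ∑ k, d' k x) p μ) := by
    rw [← hconst]
    exact sum_rpow_le_of_le hq fun ε => (hd' ε).1
  have h3 : c * eLpNorm (fun x => ∑ k, d k x) p μ
      ≤ c * (β ^ 2 * K * eLpNorm (fun x => ∑ k, d' k x) p μ) :=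
    calc _ ≤ β * (K * (β * (c * eLpNorm (fun x => ∑ k, d' k x) p μ))) :=
          h1.trans (mul_le_mul' le_rfl (h.trans (mul_le_mul' le_rfl h2)))
      _ = _ := by ring
  exact (ENNReal.mul_le_mul_iff_right hc0 hct).1 h3

/-- The form needed for whole cubes `U k`, where `h` and the sum of the stripe functions play the
roles of `ψ` and `φ` in either order. -/
theorem IsUMDBound.eLpNorm_sum_smul_le_of_average
    {X : Type u} [mX : MeasurableSpace X] {μ : Measure X} [SigmaFinite μ]
    {E : Type v} [NormedAddCommGroup E] [NormedSpace ℝ E] [CompleteSpace E]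
    {𝕜 : Type*} [RCLike 𝕜] [NormedSpace 𝕜 E] [IsScalarTower ℝ 𝕜 E]
    {p : ℝ≥0∞} {β : ℝ≥0} {κ : Type*} [Fintype κ] (hp : 1 ≤ p) (hp' : p ≠ ∞)
    (hβ : IsUMDBound.{u, v} E p β) {U : κ → Set X}
    (hU : ∀ k, MeasurableSet (U k)) (h0 : ∀ k, μ (U k) ≠ 0) (hfin : ∀ k, μ (U k) ≠ ∞)
    (hnest : NestedFamily U) {ψ φ : κ → X → 𝕜} {a : κ → E}
    (hψd : SignUnconditional p μ β fun k x => ψ k x • a k)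
    (hφd : SignUnconditional p μ β fun k x => φ k x • a k)
    (hψ : ∀ k, MemLp (ψ k) p μ) (hφ : ∀ k, MemLp (φ k) p μ)
    (hψU : ∀ k, ∀ᵐ x ∂μ, x ∉ U k → ψ k x = 0) (hφU : ∀ k, ∀ᵐ x ∂μ, x ∉ U k → φ k x = 0)
    (K : ℝ≥0) (hK : ∀ k, eLpNorm (ψ k) ∞ μ ≤ K * ((μ (U k))⁻¹ * ∫⁻ x, ‖φ k x‖ₑ ∂μ)) :
    eLpNorm (fun x => ∑ k, ψ k x • a k) p μ
      ≤ β ^ 2 * (4 * (1 + β) * K) * eLpNorm (fun x => ∑ k, φ k x • a k) p μ := by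
  classical
  exact eLpNorm_sum_le_of_signNorm_le hp hp' hψd hφd
    (hβ.signNorm_smul_le_of_average hp hp' hU h0 hfin hnest (fun k => (hψ k).1) hφ hψU hφU K hK a)

/-! ### Dyadic cubes and stripes -/

section Cubes

variable {X : Type u} [mX : MeasurableSpace X] {H : HomogeneousSpace X}

theorem HomogeneousSpace.measurableSet_of_qopen {A : Set X} (hA : H.toQuasiMetric.QOpen A) :
    MeasurableSet A := by
  rw [H.borel]
  exact MeasurableSpace.measurableSet_generateFrom hA

theorem HomogeneousSpace.sigmaFinite_vol (H : HomogeneousSpace X) : SigmaFinite H.vol := by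
  rcases isEmpty_or_nonempty X with h | ⟨⟨x₀⟩⟩
  · rw [Measure.eq_zero_of_isEmpty H.vol]
    infer_instance
  · refine ⟨⟨⟨fun n : ℕ => H.toQuasiMetric.ball x₀ (n + 1), fun _ => trivial,
      fun n => H.vol_ball_lt_top x₀ _ (by positivity), eq_univ_of_forall fun x => ?_⟩⟩⟩
    obtain ⟨n, hn⟩ := exists_nat_gt (H.d x₀ x)
    refine mem_iUnion.2 ⟨n, ?_⟩
    change H.d x₀ x < n + 1
    linarith

variable {D : DyadicSystem H}

theorem DyadicSystem.measurableSet_cube {n : ℤ} {A : Set X} (hA : A ∈ D.cubes n) :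
    MeasurableSet A :=
  H.measurableSet_of_qopen (D.open_cube n A hA)

theorem DyadicSystem.vol_cube_ne_zero {n : ℤ} {A : Set X} (hA : A ∈ D.cubes n) :
    H.vol A ≠ 0 := by
  have hr : 0 < D.C1 * D.q ^ n := mul_pos D.C1_pos (zpow_pos D.q_pos n)
  have h := H.vol_ball_pos (D.center n A) (D.C1 * D.q ^ n / 2) (by linarith)
  rw [mul_div_cancel₀ _ two_ne_zero] at h
  exact (h.trans_le (measure_mono (D.ball_subset n A hA))).ne'

theorem DyadicSystem.vol_cube_ne_top {n : ℤ} {A : Set X} (hA : A ∈ D.cubes n) :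
    H.vol A ≠ ∞ :=
  ((measure_mono (D.subset_ball n A hA)).trans_lt
    (H.vol_ball_lt_top _ _ (mul_pos D.C2_pos (zpow_pos D.q_pos n)))).ne

theorem DyadicSystem.eq_or_disjoint {n : ℤ} {A B : Set X} (hA : A ∈ D.cubes n)
    (hB : B ∈ D.cubes n) : A = B ∨ Disjoint A B := by
  rcases D.nested n n le_rfl A hA B hB with h | h
  · rcases D.nested n n le_rfl B hB A hA with h' | h'
    · exact Or.inl (h'.antisymm h)
    · exact Or.inr (disjoint_iff_inter_eq_empty.2 h').symm
  · exact Or.inr (disjoint_iff_inter_eq_empty.2 h)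

theorem DyadicSystem.Cube.carrier_injective_of_lev {A B : D.Cube} (h : A.lev = B.lev)
    (h' : A.carrier = B.carrier) : A = B := by
  cases A
  cases B
  cases h
  cases h'
  rfl

theorem DyadicSystem.Cube.disjoint_of_lev_eq {A B : D.Cube} (hAB : A ≠ B) (h : A.lev = B.lev) :
    Disjoint A.carrier B.carrier :=
  (D.eq_or_disjoint A.mem (h ▸ B.mem)).resolve_left fun h' =>
    hAB (DyadicSystem.Cube.carrier_injective_of_lev h h')

theorem DyadicSystem.nestedFamily_cubes {κ : Type*} (A : κ → D.Cube) :
    NestedFamily fun k => (A k).carrier := by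
  intro i j
  rcases le_total (A i).lev (A j).lev with h | h
  · rcases D.nested _ _ h _ (A i).mem _ (A j).mem with h | h
    · exact Or.inr (Or.inl h)
    · exact Or.inr (Or.inr (disjoint_iff_inter_eq_empty.2 h))
  · rcases D.nested _ _ h _ (A j).mem _ (A i).mem with h | h
    · exact Or.inl h
    · exact Or.inr (Or.inr (disjoint_iff_inter_eq_empty.2 h).symm)

end Cubes

section Stripes

variable {X : Type u} [mX : MeasurableSpace X] {H : HomogeneousSpace X} {D : DyadicSystem H}
  {lam M : ℕ} {K₁ K₂ ε : ℝ} (S : Stripes D lam M K₁ K₂ ε)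

theorem Stripes.measurableSet_sUnion (m : Fin M) (A : D.Cube) :
    MeasurableSet (⋃₀ S.stripe m A) :=
  MeasurableSet.sUnion ((D.countable_cubes _).mono fun _ hB => (S.stripe_subset m A hB).1)
    fun _ hB => D.measurableSet_cube (S.stripe_subset m A hB).1

theorem Stripes.sUnion_subset (m : Fin M) (A : D.Cube) : ⋃₀ S.stripe m A ⊆ A.carrier :=
  Set.sUnion_subset fun _ hB => (S.stripe_subset m A hB).2

/-- The `M` stripes of a cube are disjoint and comparable, so each takes at most about the share `1
/ M` of the cube. Since they cover the cube up to a null set, the share is also at least of that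
order, which is `Stripes.vol_cube_le`. -/
theorem Stripes.mul_vol_sUnion_le (m : Fin M) (A : D.Cube) :
    M * H.vol (⋃₀ S.stripe m A) ≤ ENNReal.ofReal K₁ * H.vol A.carrier := by
  have h1 : ∑ n, H.vol (⋃₀ S.stripe n A) ≤ H.vol A.carrier := by
    rw [← tsum_fintype (L := .unconditional _), ← measure_iUnion (fun i j hij => S.disjoint A i j hij)
      fun i => S.measurableSet_sUnion i A]
    exact measure_mono (iUnion_subset fun n => S.sUnion_subset n A)
  calc M * H.vol (⋃₀ S.stripe m A) = ∑ _n : Fin M, H.vol (⋃₀ S.stripe m A) := by simp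
    _ ≤ ∑ n, ENNReal.ofReal K₁ * H.vol (⋃₀ S.stripe n A) :=
        Finset.sum_le_sum fun n _ => S.comparable A m n
    _ ≤ _ := by
        rw [← Finset.mul_sum]
        gcongr

theorem Stripes.vol_cube_le (m : Fin M) (A : D.Cube) :
    H.vol A.carrier ≤ M * (ENNReal.ofReal K₁ * H.vol (⋃₀ S.stripe m A)) :=
  calc H.vol A.carrier ≤ H.vol (A.carrier \ ⋃ n, ⋃₀ S.stripe n A) + H.vol (⋃ n, ⋃₀ S.stripe n A) :=
        (measure_mono (by rw [sdiff_union_self]; exact subset_union_left)).trans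
          (measure_union_le _ _)
    _ ≤ ∑ n, H.vol (⋃₀ S.stripe n A) := by
        rw [S.cover A, zero_add]
        exact (measure_iUnion_le _).trans (tsum_fintype _).le
    _ ≤ ∑ _n : Fin M, ENNReal.ofReal K₁ * H.vol (⋃₀ S.stripe m A) :=
        Finset.sum_le_sum fun n _ => S.comparable A n m
    _ = _ := by simp

theorem Stripes.vol_sUnion_ne_zero (m : Fin M) (A : D.Cube) : H.vol (⋃₀ S.stripe m A) ≠ 0 := by
  intro h
  have := S.vol_cube_le m A
  rw [h, mul_zero, mul_zero] at this
  exact D.vol_cube_ne_zero A.mem (le_zero_iff.1 this)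

theorem Stripes.vol_sUnion_ne_top (m : Fin M) (A : D.Cube) : H.vol (⋃₀ S.stripe m A) ≠ ∞ :=
  ((measure_mono (S.sUnion_subset m A)).trans_lt (D.vol_cube_ne_top A.mem).lt_top).ne

/-- The stripe is a union of cubes of level `A.lev + lam`, and `B` lies in exactly one cube of that
level. -/
theorem Stripes.subset_or_disjoint (m : Fin M) (A : D.Cube) {B : D.Cube}
    (h : A.lev + lam ≤ B.lev) :
    B.carrier ⊆ ⋃₀ S.stripe m A ∨ Disjoint B.carrier (⋃₀ S.stripe m A) := by
  obtain ⟨C, ⟨hC, hBC⟩, -⟩ := D.ancestor _ _ h B.carrier B.mem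
  by_cases hCm : C ∈ S.stripe m A
  · exact Or.inl (hBC.trans (subset_sUnion_of_mem hCm))
  · refine Or.inr (disjoint_sUnion_right.2 fun C' hC' => ?_)
    refine ((D.eq_or_disjoint hC (S.stripe_subset m A hC').1).resolve_left ?_).mono_left hBC
    rintro rfl
    exact hCm hC'

theorem Stripes.nestedFamily {κ : Type*} (m : Fin M) (A : κ → D.Cube) :
    NestedFamily fun k => ⋃₀ S.stripe m (A k) := by
  intro i j
  rcases S.nested m (A i) (A j) with h | h | h
  · exact Or.inl (inter_eq_left.1 h)
  · exact Or.inr (Or.inl (inter_eq_right.1 h))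
  · exact Or.inr (Or.inr (disjoint_iff_inter_eq_empty.2 h))

end Stripes

/-! ### Comparison of two stripes within a sparse family of cubes -/

section Core

variable {X : Type u} [mX : MeasurableSpace X] {H : HomogeneousSpace X} {D : DyadicSystem H}
  {lam M : ℕ} {K₁ K₂ ε : ℝ} (S : Stripes D lam M K₁ K₂ ε) {κ : Type*} (A : κ → D.Cube)
  (m n : Fin M)

/-- The union of the two stripes of index `m` and `n`. -/
def Stripes.pair (B : D.Cube) : Set X := ⋃₀ S.stripe m B ∪ ⋃₀ S.stripe n B

/-- The levels, grouped in blocks of length `lam`, lie in the same block, and `B` is deeper. -/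
def DeeperInBlock (lam : ℕ) (A B : D.Cube) : Prop := A.lev < B.lev ∧ A.lev / lam = B.lev / lam

/-- The two stripes of the cube `A i`, without the stripes of the deeper cubes of the same block. -/
def Stripes.core (i : κ) : Set X :=
  S.pair m n (A i) \ ⋃ j ∈ {j | DeeperInBlock lam (A i) (A j)}, S.pair m n (A j)

variable {m n} {A}

theorem Stripes.measurableSet_pair (B : D.Cube) : MeasurableSet (S.pair m n B) :=
  (S.measurableSet_sUnion m B).union (S.measurableSet_sUnion n B)

theorem Stripes.pair_subset (B : D.Cube) : S.pair m n B ⊆ B.carrier :=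
  union_subset (S.sUnion_subset m B) (S.sUnion_subset n B)

theorem Stripes.core_subset_pair (i : κ) : S.core A m n i ⊆ S.pair m n (A i) := sdiff_subset

theorem Stripes.measurableSet_core [Finite κ] (i : κ) : MeasurableSet (S.core A m n i) :=
  (S.measurableSet_pair _).diff (MeasurableSet.biUnion (to_countable _) fun _ _ =>
    S.measurableSet_pair _)

theorem Stripes.pair_subset_or_disjoint {B C : D.Cube} (h : B.lev + lam ≤ C.lev) :
    C.carrier ⊆ S.pair m n B ∨ Disjoint C.carrier (S.pair m n B) := by
  rcases S.subset_or_disjoint m B h with h1 | h1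
  · exact Or.inl (h1.trans subset_union_left)
  · rcases S.subset_or_disjoint n B h with h2 | h2
    · exact Or.inl (h2.trans subset_union_right)
    · exact Or.inr (disjoint_union_right.2 ⟨h1, h2⟩)

theorem lev_add_le_of_blocks {a b : ℤ} {l : ℕ} (hl : 0 < l) (h : a / l + 2 ≤ b / l) :
    a + l ≤ b := by
  have hl' : (0 : ℤ) < l := by exact_mod_cast hl
  have h1 : a < (a / l + 1) * l := Int.lt_ediv_add_one_mul_self a hl'
  have h2 : b / l * l ≤ b := Int.ediv_mul_le b hl'.ne'
  have h3 : (a / l + 2) * l ≤ b / l * l := mul_le_mul_of_nonneg_right h hl'.le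
  nlinarith

/-- Within one block the cores are disjoint, because the deeper pair has been removed. Different
blocks of equal parity are at least two apart, so the deeper cube is at least `lam` levels below
every cube of the upper block and is not cut by any of their stripes. -/
theorem Stripes.nestedFamily_core (hlam : 0 < lam) (hA : Function.Injective A)
    (hpar : ∀ i j, ((A i).lev / lam) % 2 = ((A j).lev / lam) % 2) :
    NestedFamily (S.core A m n) := by
  have key : ∀ i j, (A i).lev < (A j).lev →
      S.core A m n j ⊆ S.core A m n i ∨ Disjoint (S.core A m n i) (S.core A m n j) := by
    intro i j hij
    by_cases hb : (A i).lev / lam = (A j).lev / lam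
    · refine Or.inr (Disjoint.mono_right (S.core_subset_pair j) ?_)
      refine disjoint_sdiff_left.mono_right ?_
      exact subset_biUnion_of_mem (u := fun j => S.pair m n (A j))
        (show j ∈ {j | DeeperInBlock lam (A i) (A j)} from ⟨hij, hb⟩)
    · have hle : (A i).lev / lam ≤ (A j).lev / lam := Int.ediv_le_ediv (by exact_mod_cast hlam) hij.le
      have hp := hpar i j
      have h2 : (A i).lev / lam + 2 ≤ (A j).lev / lam := by omega
      have hsub : S.core A m n j ⊆ (A j).carrier := (S.core_subset_pair j).trans (S.pair_subset _)
      rcases S.pair_subset_or_disjoint (m := m) (n := n) (lev_add_le_of_blocks hlam h2) with h | h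
      -- Either one of the removed pairs swallows the cube `A j`, or all of them miss it.
      · by_cases hc : ∃ l, DeeperInBlock lam (A i) (A l) ∧ (A j).carrier ⊆ S.pair m n (A l)
        · obtain ⟨l, hl, hjl⟩ := hc
          refine Or.inr (disjoint_sdiff_left.mono_right (hsub.trans (hjl.trans ?_)))
          exact subset_biUnion_of_mem (u := fun j => S.pair m n (A j))
            (show l ∈ {j | DeeperInBlock lam (A i) (A j)} from hl)
        · refine Or.inl (hsub.trans (subset_sdiff.2 ⟨h, disjoint_iUnion₂_right.2 fun l hl => ?_⟩))
          have hl : DeeperInBlock lam (A i) (A l) := hl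
          refine (S.pair_subset_or_disjoint (lev_add_le_of_blocks hlam (hl.2 ▸ h2))).resolve_left ?_
          exact fun h' => hc ⟨l, hl, h'⟩
      · exact Or.inr ((h.mono hsub (S.core_subset_pair i)).symm)
  intro i j
  rcases lt_trichotomy (A i).lev (A j).lev with h | h | h
  · rcases key i j h with h | h
    exacts [Or.inr (Or.inl h), Or.inr (Or.inr h)]
  · by_cases hij : i = j
    · exact Or.inl (hij ▸ subset_rfl)
    · refine Or.inr (Or.inr ?_)
      exact (DyadicSystem.Cube.disjoint_of_lev_eq (fun h' => hij (hA h')) h).mono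
        ((S.core_subset_pair i).trans (S.pair_subset _))
        ((S.core_subset_pair j).trans (S.pair_subset _))
  · rcases key j i h with h | h
    exacts [Or.inl h, Or.inr (Or.inr h.symm)]

theorem Stripes.mul_vol_pair_le (B : D.Cube) :
    M * H.vol (S.pair m n B) ≤ 2 * (ENNReal.ofReal K₁ * H.vol B.carrier) := by
  refine (mul_le_mul' le_rfl (measure_union_le _ _)).trans ?_
  rw [mul_add, two_mul]
  exact add_le_add (S.mul_vol_sUnion_le m B) (S.mul_vol_sUnion_le n B)

/-- The cubes of a given level that meet the stripe of index `r` have small total measure. -/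
theorem Stripes.sum_vol_le [Fintype κ] (hA : Function.Injective A) (r : Fin M) (i : κ) {l : ℕ}
    (hl : l < lam) (t : Finset κ) (ht : ∀ j ∈ t, (A j).lev = (A i).lev + l ∧
      ((A j).carrier ∩ ⋃₀ S.stripe r (A i)).Nonempty) :
    ∑ j ∈ t, H.vol (A j).carrier
      ≤ ENNReal.ofReal (K₂ * D.q ^ ((l : ℝ) * ε)) * H.vol (A i).carrier := by
  rw [← measure_biUnion_finset]
  · refine (measure_mono (iUnion₂_subset fun j hj => ?_)).trans (S.decay r (A i) l hl)
    obtain ⟨h1, h2⟩ := ht j hj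
    exact subset_sUnion_of_mem (show _ ∈ {B | B ∈ D.cubes ((A i).lev + l) ∧ _} from
      ⟨h1 ▸ (A j).mem, h2⟩)
  · intro j hj j' hj' hne
    exact DyadicSystem.Cube.disjoint_of_lev_eq (fun h => hne (hA h))
      ((ht j hj).1.trans (ht j' hj').1.symm)
  · exact fun j _ => D.measurableSet_cube (A j).mem

/-- Half of each stripe is contained in the core. -/
theorem Stripes.vol_sUnion_le_two_mul [Fintype κ] (hlam : 0 < lam) (hA : Function.Injective A)
    {k : ℕ} (hk : ∀ i j, (A i).lev < (A j).lev → (A i).lev + k ≤ (A j).lev) {θ : ℝ≥0∞}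
    (hθ : ∑ l ∈ Finset.Ico k lam, ENNReal.ofReal (K₂ * D.q ^ ((l : ℝ) * ε)) ≤ θ)
    (hθ' : 2 * (2 * ENNReal.ofReal K₁ ^ 2 * θ) ≤ 1) (hM : 0 < M) {r : Fin M} (hr : r = m ∨ r = n)
    (i : κ) :
    H.vol (⋃₀ S.stripe r (A i)) ≤ 2 * H.vol (S.core A m n i ∩ ⋃₀ S.stripe r (A i)) := by
  classical
  set s := ⋃₀ S.stripe r (A i) with hs
  have hfin : H.vol s ≠ ∞ := S.vol_sUnion_ne_top r (A i)
  let t : Finset κ := Finset.univ.filter fun j =>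
    DeeperInBlock lam (A i) (A j) ∧ ((A j).carrier ∩ s).Nonempty
  have hsub : s ⊆ (S.core A m n i ∩ s) ∪ ⋃ j ∈ t, S.pair m n (A j) := by
    intro x hx
    by_cases hx' : x ∈ ⋃ j ∈ {j | DeeperInBlock lam (A i) (A j)}, S.pair m n (A j)
    · obtain ⟨j, hj, hxj⟩ := mem_iUnion₂.1 hx'
      refine Or.inr (mem_iUnion₂.2 ⟨j, ?_, hxj⟩)
      exact Finset.mem_filter.2 ⟨Finset.mem_univ _, hj, x, S.pair_subset _ hxj, hx⟩
    · refine Or.inl ⟨⟨?_, hx'⟩, hx⟩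
      rcases hr with rfl | rfl
      exacts [Or.inl hx, Or.inr hx]
  -- Sparsity makes the difference of levels at least `k`, and two levels of one block differ by
  -- less than `lam`, the range of (S4).
  have hlev : ∀ j ∈ t, ∃ l ∈ Finset.Ico k lam, (A j).lev = (A i).lev + (l : ℕ) := by
    intro j hj
    obtain ⟨⟨h1, h2⟩, -⟩ := (Finset.mem_filter.1 hj).2
    have h3 := hk i j h1
    have hl' : (0 : ℤ) < lam := by exact_mod_cast hlam
    have h4 : (A j).lev < ((A j).lev / lam + 1) * lam := Int.lt_ediv_add_one_mul_self _ hl'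
    have h5 : (A i).lev / lam * lam ≤ (A i).lev := Int.ediv_mul_le _ hl'.ne'
    refine ⟨((A j).lev - (A i).lev).toNat, Finset.mem_Ico.2 ⟨by omega, ?_⟩, by omega⟩
    rw [h2] at h5
    have : (A j).lev - (A i).lev < lam := by linarith
    omega
  have hcubes : ∑ j ∈ t, H.vol (A j).carrier ≤ θ * H.vol (A i).carrier := by
    have h1 : t = (Finset.Ico k lam).biUnion fun l : ℕ =>
        t.filter fun j => (A j).lev = (A i).lev + l := by
      ext j
      simp only [Finset.mem_biUnion, Finset.mem_filter]
      constructor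
      · intro hj
        obtain ⟨l, hl, h⟩ := hlev j hj
        exact ⟨l, hl, hj, h⟩
      · rintro ⟨_, _, hj, _⟩
        exact hj
    rw [h1, Finset.sum_biUnion fun l _ l' _ hne => Finset.disjoint_left.2 fun j hj hj' => hne (by
      have := (Finset.mem_filter.1 hj).2.symm.trans (Finset.mem_filter.1 hj').2
      omega)]
    refine le_trans ?_ (mul_le_mul' hθ le_rfl)
    rw [Finset.sum_mul]
    refine Finset.sum_le_sum fun l hl => ?_
    refine S.sum_vol_le hA r i (Finset.mem_Ico.1 hl).2 _ fun j hj => ?_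
    obtain ⟨h1, h2⟩ := Finset.mem_filter.1 hj
    exact ⟨h2, (Finset.mem_filter.1 h1).2.2⟩
  -- A pair has at most the share `2 K₁ / M` of its cube, while `A i` has at most `M K₁` times the
  -- measure of `s`; thus `M` cancels.
  have hpairs : M * H.vol (⋃ j ∈ t, S.pair m n (A j))
      ≤ M * (2 * ENNReal.ofReal K₁ ^ 2 * θ * H.vol s) :=
    calc M * H.vol (⋃ j ∈ t, S.pair m n (A j)) ≤ ∑ j ∈ t, M * H.vol (S.pair m n (A j)) := by
          rw [← Finset.mul_sum]
          exact mul_le_mul' le_rfl (measure_biUnion_finset_le _ _)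
      _ ≤ ∑ j ∈ t, 2 * (ENNReal.ofReal K₁ * H.vol (A j).carrier) :=
          Finset.sum_le_sum fun j _ => S.mul_vol_pair_le (A j)
      _ = 2 * (ENNReal.ofReal K₁ * ∑ j ∈ t, H.vol (A j).carrier) := by
          rw [Finset.mul_sum, Finset.mul_sum]
      _ ≤ 2 * (ENNReal.ofReal K₁ * (θ * (M * (ENNReal.ofReal K₁ * H.vol s)))) := by
          gcongr
          exact hcubes.trans (mul_le_mul' le_rfl (S.vol_cube_le r (A i)))
      _ = _ := by ring
  have hM0 : (M : ℝ≥0∞) ≠ 0 := by exact_mod_cast hM.ne'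
  have hpairs' := (ENNReal.mul_le_mul_iff_right hM0 (ENNReal.natCast_ne_top M)).1 hpairs
  -- The removed part is at most half of `s` by the choice of `θ`; one copy of the finite `H.vol s`
  -- is then subtracted.
  have h2 : 2 * H.vol s ≤ 2 * H.vol (S.core A m n i ∩ s) + H.vol s :=
    calc 2 * H.vol s ≤ 2 * (H.vol (S.core A m n i ∩ s)
          + 2 * ENNReal.ofReal K₁ ^ 2 * θ * H.vol s) := by
          gcongr
          exact (measure_mono hsub).trans ((measure_union_le _ _).trans
            (add_le_add le_rfl hpairs'))
      _ = 2 * H.vol (S.core A m n i ∩ s) + 2 * (2 * ENNReal.ofReal K₁ ^ 2 * θ) * H.vol s := by ring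
      _ ≤ 2 * H.vol (S.core A m n i ∩ s) + 1 * H.vol s := by gcongr
      _ = _ := by rw [one_mul]
  rw [two_mul] at h2
  exact (ENNReal.add_le_add_iff_right hfin).1 h2

end Core

/-! ### Comparison of two stripe operators -/

section Compare

variable {X : Type u} [mX : MeasurableSpace X] {H : HomogeneousSpace X} {D : DyadicSystem H}
  {lam M : ℕ} {K₁ K₂ ε : ℝ} {S : Stripes D lam M K₁ K₂ ε}
  {𝕜 : Type*} [RCLike 𝕜] {p : ℝ≥0∞} {Cg : ℝ}
  {E : Type v} [NormedAddCommGroup E] [NormedSpace ℝ E] [CompleteSpace E]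
  [NormedSpace 𝕜 E] [IsScalarTower ℝ 𝕜 E] {β : ℝ≥0}

theorem le_mul_average {V w c K : ℝ≥0∞} (h0 : V ≠ 0) (hfin : V ≠ ∞) (h : V ≤ K * w) :
    c ≤ K * (V⁻¹ * (c * w)) :=
  calc c = c * (V⁻¹ * V) := by rw [ENNReal.inv_mul_cancel h0 hfin, mul_one]
    _ ≤ c * (V⁻¹ * (K * w)) := by gcongr
    _ = _ := by ring

theorem lintegral_enorm_indicator_const {μ : Measure X} {U : Set X} (hU : MeasurableSet U) {c : ℝ}
    (hc : 0 ≤ c) : ∫⁻ x, ‖U.indicator (fun _ => (c : 𝕜)) x‖ₑ ∂μ = ENNReal.ofReal c * μ U := by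
  simp only [enorm_indicator_eq_indicator_enorm]
  rw [lintegral_indicator_const hU, ← ofReal_norm, RCLike.norm_ofReal, abs_of_nonneg hc]

theorem eLpNorm_top_indicator_const_le {μ : Measure X} {U : Set X} {c : ℝ} (hc : 0 ≤ c) :
    eLpNorm (U.indicator fun _ => (c : 𝕜)) ∞ μ ≤ ENNReal.ofReal c := by
  rw [eLpNorm_exponent_top]
  refine (eLpNormEssSup_indicator_const_le U (c : 𝕜)).trans (le_of_eq ?_)
  rw [← ofReal_norm, RCLike.norm_ofReal, abs_of_nonneg hc]

/-- The constant in the comparison of two stripe operators within a sparse family of cubes. -/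
def sparseConst (β : ℝ≥0) (K₁ Cg : ℝ) : ℝ≥0 :=
  β ^ 2 * (4 * (1 + β) * (2 * Cg.toNNReal) *
    (4 * (1 + β) * (2 * (1 + K₁.toNNReal)) * (4 * (1 + β) * 1)))

/-- The two stripes are linked through the core. With `c i` the average of `|g^(n)|` over its
stripe, `g^(m)` is replaced by `c i` on core and stripe `m`, this by `c i` on core and stripe `n`,
and this by `g^(n)`. The nested families are the stripes `m`, the cores and the stripes `n`. -/
theorem StripeFunctions.eLpNorm_sum_le_of_sparse (F : StripeFunctions S 𝕜 p Cg) (hp : 1 ≤ p)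
    (hp' : p ≠ ∞) (hβ : IsUMDBound.{u, v} E p β) {κ : Type*} [Fintype κ] {A : κ → D.Cube}
    (hlam : 0 < lam) (hM : 0 < M) (hA : Function.Injective A)
    (hpar : ∀ i j, ((A i).lev / lam) % 2 = ((A j).lev / lam) % 2)
    {k : ℕ} (hk : ∀ i j, (A i).lev < (A j).lev → (A i).lev + k ≤ (A j).lev) {θ : ℝ≥0∞}
    (hθ : ∑ l ∈ Finset.Ico k lam, ENNReal.ofReal (K₂ * D.q ^ ((l : ℝ) * ε)) ≤ θ)
    (hθ' : 2 * (2 * ENNReal.ofReal K₁ ^ 2 * θ) ≤ 1) {m n : Fin M} (hmn : m ≠ n) (a : κ → E) :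
    eLpNorm (fun x => ∑ i, F.g m (A i) x • a i) p H.vol
      ≤ sparseConst β K₁ Cg * eLpNorm (fun x => ∑ i, F.g n (A i) x • a i) p H.vol := by
  classical
  have hσ := H.sigmaFinite_vol
  have hhalf : ∀ {r : Fin M}, r = m ∨ r = n → ∀ i, H.vol (⋃₀ S.stripe r (A i))
      ≤ 2 * H.vol (S.core A m n i ∩ ⋃₀ S.stripe r (A i)) := fun hr i =>
    S.vol_sUnion_le_two_mul hlam hA hk hθ hθ' hM hr i
  have hcore := S.nestedFamily_core (m := m) (n := n) hlam hA hpar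
  have hcm : ∀ i, MeasurableSet (S.core A m n i) := fun i => S.measurableSet_core i
  have hcs : ∀ r i, MeasurableSet (S.core A m n i ∩ ⋃₀ S.stripe r (A i)) := fun r i =>
    (hcm i).inter (S.measurableSet_sUnion r (A i))
  have hcfin : ∀ i, H.vol (S.core A m n i) ≠ ∞ := fun i =>
    ((measure_mono ((S.core_subset_pair i).trans (S.pair_subset _))).trans_lt
      (D.vol_cube_ne_top (A i).mem).lt_top).ne
  have hcpos : ∀ i, H.vol (S.core A m n i) ≠ 0 := fun i h => by
    have h1 := hhalf (Or.inl rfl) i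
    rw [measure_mono_null inter_subset_left h, mul_zero] at h1
    exact S.vol_sUnion_ne_zero m (A i) (le_zero_iff.1 h1)
  have hcle : ∀ i, H.vol (S.core A m n i) ≤ ((2 * (1 + K₁.toNNReal) : ℝ≥0) : ℝ≥0∞)
      * H.vol (S.core A m n i ∩ ⋃₀ S.stripe n (A i)) := fun i =>
    calc H.vol (S.core A m n i) ≤ H.vol (⋃₀ S.stripe m (A i)) + H.vol (⋃₀ S.stripe n (A i)) :=
          (measure_mono (S.core_subset_pair i)).trans (measure_union_le _ _)
      _ ≤ ENNReal.ofReal K₁ * H.vol (⋃₀ S.stripe n (A i)) + H.vol (⋃₀ S.stripe n (A i)) :=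
          add_le_add (S.comparable (A i) m n) le_rfl
      _ = (1 + ENNReal.ofReal K₁) * H.vol (⋃₀ S.stripe n (A i)) := by ring
      _ ≤ (1 + ENNReal.ofReal K₁) *
            (2 * H.vol (S.core A m n i ∩ ⋃₀ S.stripe n (A i))) := by
          gcongr
          exact hhalf (Or.inr rfl) i
      _ = _ := by
          push_cast
          rw [ENNReal.ofReal]
          ring
  let c : κ → ℝ := fun i =>
    ((H.vol (⋃₀ S.stripe n (A i)))⁻¹ * ∫⁻ x, ‖F.g n (A i) x‖ₑ ∂H.vol).toReal
  have hc0 : ∀ i, 0 ≤ c i := fun i => ENNReal.toReal_nonneg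
  have hgi : ∀ i, Integrable (F.g n (A i)) H.vol := fun i =>
    integrable_of_memLp_of_eq_zero hp (F.g_memLp n (A i)) (S.vol_sUnion_ne_top n (A i))
      (F.g_supp n (A i))
  have hc : ∀ i, ENNReal.ofReal (c i)
      = (H.vol (⋃₀ S.stripe n (A i)))⁻¹ * ∫⁻ x, ‖F.g n (A i) x‖ₑ ∂H.vol := fun i =>
    ENNReal.ofReal_toReal (ENNReal.mul_ne_top
      (ENNReal.inv_ne_top.2 (S.vol_sUnion_ne_zero n (A i))) (hgi i).2.ne)
  let w : Fin M → κ → X → 𝕜 := fun r i =>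
    (S.core A m n i ∩ ⋃₀ S.stripe r (A i)).indicator fun _ => (c i : 𝕜)
  have hw : ∀ r i, MemLp (w r i) p H.vol := fun r i =>
    memLp_indicator_const p (hcs r i) _
      (Or.inr ((measure_mono inter_subset_left).trans_lt (hcfin i).lt_top).ne)
  have hwcore : ∀ r i, ∀ᵐ x ∂H.vol, x ∉ S.core A m n i → w r i x = 0 := fun r i =>
    Filter.Eventually.of_forall fun x hx => indicator_of_notMem (fun h => hx h.1) _
  have hwstripe : ∀ r i, ∀ᵐ x ∂H.vol, x ∉ ⋃₀ S.stripe r (A i) → w r i x = 0 := fun r i =>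
    Filter.Eventually.of_forall fun x hx => indicator_of_notMem (fun h => hx h.2) _
  have hw1 : ∀ r i, ∫⁻ x, ‖w r i x‖ₑ ∂H.vol = ENNReal.ofReal (c i)
      * H.vol (S.core A m n i ∩ ⋃₀ S.stripe r (A i)) := fun r i =>
    lintegral_enorm_indicator_const (hcs r i) (hc0 i)
  have hwtop : ∀ r i, eLpNorm (w r i) ∞ H.vol ≤ ENNReal.ofReal (c i) := fun r i =>
    eLpNorm_top_indicator_const_le (hc0 i)
  -- `Cg` comes from (G3), and the factor 2 from the core filling half of the stripe.
  have step1 := hβ.signNorm_smul_le_of_average hp hp'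
    (fun i => S.measurableSet_sUnion m (A i)) (fun i => S.vol_sUnion_ne_zero m (A i))
    (fun i => S.vol_sUnion_ne_top m (A i)) (S.nestedFamily m A)
    (ψ := fun i => F.g m (A i)) (φ := w m) (fun i => (F.g_memLp m (A i)).1) (hw m)
    (fun i => F.g_supp m (A i)) (hwstripe m) (2 * Cg.toNNReal) (fun i => by
      rw [hw1]
      refine (F.g_bound (A i) m n hmn).trans ?_
      rw [← hc, ENNReal.ofReal, mul_comm 2, ENNReal.coe_mul, mul_assoc]
      gcongr
      exact le_mul_average (S.vol_sUnion_ne_zero m (A i)) (S.vol_sUnion_ne_top m (A i))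
        (hhalf (Or.inl rfl) i)) a
  -- The core is at most `1 + K₁` times stripe `n`, which is at most twice its part in the core.
  have step2 := hβ.signNorm_smul_le_of_average hp hp' hcm hcpos hcfin hcore
    (ψ := w m) (φ := w n) (fun i => (hw m i).1) (hw n) (hwcore m) (hwcore n)
    (2 * (1 + K₁.toNNReal)) (fun i => by
      rw [hw1]
      exact (hwtop m i).trans (le_mul_average (hcpos i) (hcfin i) (hcle i))) a
  have step3 := hβ.signNorm_smul_le_of_average hp hp'
    (fun i => S.measurableSet_sUnion n (A i)) (fun i => S.vol_sUnion_ne_zero n (A i))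
    (fun i => S.vol_sUnion_ne_top n (A i)) (S.nestedFamily n A)
    (ψ := w n) (φ := fun i => F.g n (A i)) (fun i => (hw n i).1) (fun i => F.g_memLp n (A i))
    (hwstripe n) (fun i => F.g_supp n (A i)) 1 (fun i => by
      rw [← hc, ENNReal.coe_one, one_mul]
      exact hwtop n i) a
  have hmds : ∀ r, ConstitutesMDS H.vol fun i => F.g r (A i) := fun r =>
    F.g_mds.comp_injective (e := fun i => (r, A i)) fun i j h => hA (Prod.ext_iff.1 h).2
  have hfinal := eLpNorm_sum_le_of_signNorm_le hp hp'
    (hβ.signUnconditional ((hmds m).smul_vec a) fun i => memLp_smul_vec E (F.g_memLp m (A i)) (a i))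
    (hβ.signUnconditional ((hmds n).smul_vec a) fun i => memLp_smul_vec E (F.g_memLp n (A i)) (a i))
    (K := 4 * (1 + β) * (2 * Cg.toNNReal : ℝ≥0) *
      (4 * (1 + β) * (2 * (1 + K₁.toNNReal) : ℝ≥0) * (4 * (1 + β) * (1 : ℝ≥0)))) (by
      rw [mul_assoc _ _ (signNorm _ _ _), mul_assoc _ _ (signNorm _ _ _)]
      exact step1.trans (mul_le_mul' le_rfl (step2.trans (mul_le_mul' le_rfl step3))))
  refine hfinal.trans (le_of_eq ?_)
  congr 1

/-- The stripe operators of different index are comparable. -/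
theorem StripeFunctions.eLpNorm_sum_smul_le (F : StripeFunctions S 𝕜 p Cg) (hp : 1 ≤ p)
    (hp' : p ≠ ∞) (hβ : IsUMDBound.{u, v} E p β) {κ : Type*} [Fintype κ] {A : κ → D.Cube}
    (hlam : 0 < lam) (hM : 0 < M) (hA : Function.Injective A) {k : ℕ} (hk0 : 0 < k) {θ : ℝ≥0∞}
    (hθ : ∑ l ∈ Finset.Ico k lam, ENNReal.ofReal (K₂ * D.q ^ ((l : ℝ) * ε)) ≤ θ)
    (hθ' : 2 * (2 * ENNReal.ofReal K₁ ^ 2 * θ) ≤ 1) (m n : Fin M) (a : κ → E) :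
    eLpNorm (fun x => ∑ i, F.g m (A i) x • a i) p H.vol
      ≤ ((1 + 2 * k * (sparseConst β K₁ Cg * (1 + β)) : ℝ≥0) : ℝ≥0∞)
        * eLpNorm (fun x => ∑ i, F.g n (A i) x • a i) p H.vol := by
  classical
  have hσ := H.sigmaFinite_vol
  -- (G3) is void for `m = n`; the summand 1 of the constant covers this case.
  by_cases hmn : m = n
  · subst hmn
    refine le_mul_of_one_le_left' ?_
    exact_mod_cast le_self_add
  have : NeZero k := ⟨hk0.ne'⟩
  -- The residue modulo `k` gives sparsity, the parity of the block gives nested cores. Restricting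
  -- the sum to one of the `2k` classes costs `1 + β`.
  let cls : κ → ZMod k × ZMod 2 := fun i => ((A i).lev, (((A i).lev / lam : ℤ) : ZMod 2))
  have hmeas : ∀ i, AEStronglyMeasurable (fun x => F.g m (A i) x • a i) H.vol := fun i =>
    (memLp_smul_vec E (F.g_memLp m (A i)) (a i)).1
  have hsplit : (fun x => ∑ i, F.g m (A i) x • a i)
      = ∑ c : ZMod k × ZMod 2, fun x => ∑ i ∈ Finset.univ.filter (cls · = c),
        F.g m (A i) x • a i := by
    funext x
    rw [Finset.sum_apply]
    exact (Finset.sum_fiberwise _ cls _).symm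
  have hclass : ∀ c : ZMod k × ZMod 2,
      eLpNorm (fun x => ∑ i ∈ Finset.univ.filter (cls · = c), F.g m (A i) x • a i) p H.vol
        ≤ sparseConst β K₁ Cg * ((1 + β) * eLpNorm (fun x => ∑ i, F.g n (A i) x • a i) p H.vol) := by
    intro c
    have hsub : ∀ r x, ∑ i ∈ Finset.univ.filter (cls · = c), F.g r (A i) x • a i
        = ∑ i : {i // cls i = c}, F.g r (A i) x • a i := fun r x =>
      Finset.sum_subtype _ (by simp) _
    have h1 := F.eLpNorm_sum_le_of_sparse hp hp' hβ (A := fun i : {i // cls i = c} => A i) hlam hM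
      (hA.comp Subtype.val_injective) (fun i j => by
        have h := (Prod.ext_iff.1 (i.2.trans j.2.symm)).2
        exact (ZMod.intCast_eq_intCast_iff _ _ 2).1 h) (k := k) (fun i j hij => by
        have h := (Prod.ext_iff.1 (i.2.trans j.2.symm)).1
        have h' := ((ZMod.intCast_eq_intCast_iff _ _ k).1 h).dvd
        have := Int.le_of_dvd (by linarith) h'
        linarith) hθ hθ' hmn (fun i => a i)
    have hmds : ConstitutesMDS H.vol fun i => F.g n (A i) :=
      F.g_mds.comp_injective (e := fun i => (n, A i)) fun i j h => hA (Prod.ext_iff.1 h).2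
    have h2 := hβ.eLpNorm_sum_finset_le hp (hmds.smul_vec a)
      (fun i => memLp_smul_vec E (F.g_memLp n (A i)) (a i)) (Finset.univ.filter (cls · = c))
    simp only [hsub] at h2 ⊢
    exact h1.trans (mul_le_mul' le_rfl h2)
  rw [hsplit]
  refine (MeasureTheory.eLpNorm_sum_le (fun c _ =>
    Finset.aestronglyMeasurable_fun_sum _ fun i _ => hmeas i) hp).trans
    ((Finset.sum_le_sum fun c _ => hclass c).trans ?_)
  rw [Finset.sum_const, Finset.card_univ, Fintype.card_prod, ZMod.card, ZMod.card, nsmul_eq_mul,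
    ← mul_assoc, ← mul_assoc]
  gcongr
  push_cast
  calc _ = 2 * (k : ℝ≥0∞) * (sparseConst β K₁ Cg * (1 + β)) := by ring
    _ ≤ _ := le_add_self

/-- The tails of the geometric series in the decay condition are small. -/
theorem exists_sum_Ico_le {q K₁ K₂ ε : ℝ} (hq : 0 < q) (hq1 : q < 1) (hK₂ : 0 < K₂)
    (hε : 0 < ε) : ∃ k : ℕ, 0 < k ∧ ∃ θ : ℝ≥0∞, 2 * (2 * ENNReal.ofReal K₁ ^ 2 * θ) ≤ 1 ∧
      ∀ lam : ℕ, ∑ l ∈ Finset.Ico k lam, ENNReal.ofReal (K₂ * q ^ ((l : ℝ) * ε)) ≤ θ := by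
  have hr0 : 0 < q ^ ε := Real.rpow_pos_of_pos hq ε
  have hr1 : q ^ ε < 1 := Real.rpow_lt_one hq.le hq1 hε
  have hpow : ∀ l : ℕ, K₂ * q ^ ((l : ℝ) * ε) = K₂ * (q ^ ε) ^ l := fun l => by
    rw [mul_comm (l : ℝ), Real.rpow_mul hq.le, Real.rpow_natCast]
  have hsum : Summable fun l : ℕ => K₂ * (q ^ ε) ^ l :=
    (summable_geometric_of_lt_one hr0.le hr1).mul_left K₂
  have htend := tendsto_sum_nat_add fun l : ℕ => K₂ * (q ^ ε) ^ l
  -- Chosen so that `4 K₁² δ ≤ 1`. The whole tail of the convergent series from `k` on is below `δ`,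
  -- so `k` does not depend on `lam`.
  let δ : ℝ := 1 / (4 * ((K₁.toNNReal : ℝ) ^ 2 + 1))
  have hδ : 0 < δ := by positivity
  obtain ⟨k, hkδ, hk0⟩ := ((htend.eventually_lt_const hδ).and (Filter.eventually_gt_atTop 0)).exists
  refine ⟨k, hk0, ENNReal.ofReal δ, ?_, fun lam => ?_⟩
  · have h1 : ENNReal.ofReal K₁ = ENNReal.ofReal (K₁.toNNReal : ℝ) := by
      rw [ENNReal.ofReal_coe_nnreal, ENNReal.ofReal]
    have h2 : 2 * (2 * ENNReal.ofReal K₁ ^ 2 * ENNReal.ofReal δ)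
        = ENNReal.ofReal (2 * (2 * (K₁.toNNReal : ℝ) ^ 2 * δ)) := by
      rw [h1, ENNReal.ofReal_mul (by norm_num), ENNReal.ofReal_mul (by positivity),
        ENNReal.ofReal_mul (by norm_num), ENNReal.ofReal_pow (by positivity)]
      norm_num
    rw [h2, ← ENNReal.ofReal_one]
    refine ENNReal.ofReal_le_ofReal ?_
    have h3 : 4 * ((K₁.toNNReal : ℝ) ^ 2 + 1) * δ = 1 := mul_one_div_cancel (by positivity)
    nlinarith
  · rw [← ENNReal.ofReal_sum_of_nonneg fun l _ => by positivity]
    refine ENNReal.ofReal_le_ofReal (le_trans ?_ hkδ.le)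
    simp only [hpow]
    rw [Finset.sum_Ico_eq_sum_range]
    simp only [add_comm k]
    exact Summable.sum_le_tsum _ (fun l _ => by positivity) ((summable_nat_add_iff k).2 hsum)

end Compare

/-! ### Finite sums in `L^p(X; E)` -/

section Synthesis

variable {X : Type u} [mX : MeasurableSpace X] {μ : Measure X} {p : ℝ≥0∞}
  {E : Type v} [NormedAddCommGroup E]

theorem coeFn_sum_Lp {ι : Type*} (s : Finset ι) (u : ι → Lp E p μ) :
    ⇑(∑ i ∈ s, u i) =ᵐ[μ] fun x => ∑ i ∈ s, u i x := by
  classical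
  induction s using Finset.induction_on with
  | empty =>
    simp only [Finset.sum_empty]
    exact Lp.coeFn_zero E p μ
  | insert i s hi ih =>
    rw [Finset.sum_insert hi]
    filter_upwards [Lp.coeFn_add (u i) (∑ i ∈ s, u i), ih] with x h1 h2
    rw [h1, Pi.add_apply, h2, Finset.sum_insert hi]

theorem coeFn_units_smul_Lp (e : ℤˣ) (u : Lp E p μ) : ⇑(e • u) =ᵐ[μ] fun x => e • u x := by
  rcases Int.units_eq_one_or e with h | h
  · subst h
    simp
  · subst h
    filter_upwards [Lp.coeFn_neg u] with x hx
    simpa using hx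

theorem enorm_sum_units_smul_Lp {ι : Type*} [Fintype ι] (θ : ι → ℤˣ) {u : ι → Lp E p μ}
    {f : ι → X → E} (h : ∀ i, u i =ᵐ[μ] f i) :
    ‖∑ i, θ i • u i‖ₑ = eLpNorm (fun x => ∑ i, θ i • f i x) p μ := by
  rw [Lp.enorm_def]
  refine eLpNorm_congr_ae ?_
  filter_upwards [coeFn_sum_Lp Finset.univ fun i => θ i • u i,
    ae_all_iff.2 fun i => coeFn_units_smul_Lp (θ i) (u i), ae_all_iff.2 h] with x h1 h2 h3
  rw [h1]
  exact Finset.sum_congr rfl fun i _ => by rw [h2, h3]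

theorem enorm_sum_Lp {ι : Type*} [Fintype ι] {u : ι → Lp E p μ} {f : ι → X → E}
    (h : ∀ i, u i =ᵐ[μ] f i) : ‖∑ i, u i‖ₑ = eLpNorm (fun x => ∑ i, f i x) p μ := by
  simpa only [one_smul] using enorm_sum_units_smul_Lp (fun _ => 1) h

theorem coeFn_synthesis {𝕜 ι : Type*} [RCLike 𝕜] [NormedSpace 𝕜 E] {φ : ι → X → 𝕜}
    (hφ : ∀ i, MemLp (φ i) p μ) (a : ι →₀ E) :
    ⇑(synthesis E hφ a) =ᵐ[μ] fun x => ∑ i : a.support, φ i x • a i := by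
  have h1 : synthesis E hφ a = ∑ i ∈ a.support, vecMul E (hφ i) (a i) := by
    rw [synthesis, Finsupp.lsum_apply]
    rfl
  have h2 : ∀ᵐ x ∂μ, ∀ i : a.support, vecMul E (hφ i) (a i) x = φ i x • a i :=
    ae_all_iff.2 fun i => (memLp_smul_vec E (hφ i) (a i)).coeFn_toLp
  rw [h1]
  filter_upwards [coeFn_sum_Lp a.support fun i => vecMul E (hφ i) (a i), h2] with x h3 h4
  rw [h3, ← Finset.sum_coe_sort]
  exact Finset.sum_congr rfl fun i _ => h4 i

theorem norm_le_mul_of_enorm_le {x y : Lp E p μ} {C : ℝ≥0} (h : ‖x‖ₑ ≤ C * ‖y‖ₑ) :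
    ‖x‖ ≤ C * ‖y‖ := by
  rw [Lp.enorm_def, Lp.enorm_def] at h
  rw [Lp.norm_def, Lp.norm_def]
  have := ENNReal.toReal_mono (ENNReal.mul_ne_top ENNReal.coe_ne_top (Lp.eLpNorm_ne_top y)) h
  rwa [ENNReal.toReal_mul, ENNReal.coe_toReal] at this

end Synthesis

/-! ### Norm estimates for the stripe operators on finite sums -/

theorem StripeFunctions.enorm_sum_synthesis {X : Type u} [MeasurableSpace X]
    {H : HomogeneousSpace X} {D : DyadicSystem H} {lam M : ℕ} {K₁ K₂ ε : ℝ}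
    {S : Stripes D lam M K₁ K₂ ε} {𝕜 : Type*} [RCLike 𝕜] {p : ℝ≥0∞} {Cg : ℝ}
    {E : Type v} [NormedAddCommGroup E] [NormedSpace 𝕜 E]
    (F : StripeFunctions S 𝕜 p Cg) (a : D.Cube →₀ E) :
    ‖∑ n, synthesis E (F.g_memLp n) a‖ₑ
      = eLpNorm (fun x => ∑ k : a.support, (∑ n, F.g n k x) • a k) p H.vol := by
  rw [enorm_sum_Lp fun n => coeFn_synthesis (F.g_memLp n) a]
  congr 1
  funext x
  rw [Finset.sum_comm]
  simp only [Finset.sum_smul]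

section Finite

variable {X : Type u} [mX : MeasurableSpace X] {H : HomogeneousSpace X} {D : DyadicSystem H}
  {lam M : ℕ} {K₁ K₂ ε : ℝ} {S : Stripes D lam M K₁ K₂ ε}
  {𝕜 : Type*} [RCLike 𝕜] {p : ℝ≥0∞} {Cg : ℝ}
  {E : Type v} [NormedAddCommGroup E] [NormedSpace ℝ E] [CompleteSpace E]
  [NormedSpace 𝕜 E] [IsScalarTower ℝ 𝕜 E] {β : ℝ≥0}

variable (F : StripeFunctions S 𝕜 p Cg) (a : D.Cube →₀ E)

theorem StripeFunctions.norm_synthesis_le (hp : 1 ≤ p) (hp' : p ≠ ∞)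
    (hβ : IsUMDBound.{u, v} E p β) (hlam : 0 < lam) (hM : 0 < M) {k : ℕ} (hk0 : 0 < k) {θ : ℝ≥0∞}
    (hθ : ∑ l ∈ Finset.Ico k lam, ENNReal.ofReal (K₂ * D.q ^ ((l : ℝ) * ε)) ≤ θ)
    (hθ' : 2 * (2 * ENNReal.ofReal K₁ ^ 2 * θ) ≤ 1) (m n : Fin M) :
    ‖synthesis E (F.g_memLp m) a‖ ≤ ((1 + 2 * k * (sparseConst β K₁ Cg * (1 + β)) : ℝ≥0) : ℝ)
      * ‖synthesis E (F.g_memLp n) a‖ := by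
  refine norm_le_mul_of_enorm_le ?_
  rw [Lp.enorm_def, Lp.enorm_def, eLpNorm_congr_ae (coeFn_synthesis (F.g_memLp m) a),
    eLpNorm_congr_ae (coeFn_synthesis (F.g_memLp n) a)]
  exact F.eLpNorm_sum_smul_le hp hp' hβ hlam hM Subtype.val_injective hk0 hθ hθ' m n _

theorem StripeFunctions.constitutesMDS_g {κ : Type*} {A : κ → D.Cube}
    (hA : Function.Injective A) (b : κ → E) :
    ConstitutesMDS H.vol fun (i : Fin M × κ) x => F.g i.1 (A i.2) x • b i.2 :=
  (F.g_mds.comp_injective (e := fun i : Fin M × κ => (i.1, A i.2)) fun _ _ h =>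
    Prod.ext (Prod.ext_iff.1 h).1 (hA (Prod.ext_iff.1 h).2)).smul_vec fun i => b i.2

/-- Signs depending on the cube alone are a special case of signs on the pairs of a stripe index and
a cube, to which (G2) applies. -/
theorem StripeFunctions.signUnconditional_sum_g (hβ : IsUMDBound.{u, v} E p β) {κ : Type*}
    [Fintype κ] {A : κ → D.Cube} (hA : Function.Injective A) (b : κ → E) :
    SignUnconditional p H.vol β fun k x => (∑ n, F.g n (A k) x) • b k := by
  have hσ := H.sigmaFinite_vol
  intro θ
  have h := hβ.signUnconditional (F.constitutesMDS_g hA b)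
    (fun i => memLp_smul_vec E (F.g_memLp i.1 (A i.2)) (b i.2)) fun i => θ i.2
  have h1 : ∀ x, ∑ i : Fin M × κ, θ i.2 • F.g i.1 (A i.2) x • b i.2
      = ∑ k, θ k • (∑ n, F.g n (A k) x) • b k := fun x => by
    rw [Fintype.sum_prod_type_right]
    simp only [Finset.sum_smul, Finset.smul_sum]
  have h2 : ∀ x, ∑ i : Fin M × κ, F.g i.1 (A i.2) x • b i.2
      = ∑ k, (∑ n, F.g n (A k) x) • b k := fun x => by
    rw [Fintype.sum_prod_type_right]
    simp only [Finset.sum_smul]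
  simpa only [h1, h2] using h

/-- Here the signs depend on the stripe index alone. This makes the Rademacher average of the `M`
stripe images comparable to the norm of their sum. -/
theorem StripeFunctions.norm_sum_units_smul (hβ : IsUMDBound.{u, v} E p β) (θ : Fin M → ℤˣ) :
    ‖∑ n, θ n • synthesis E (F.g_memLp n) a‖ ≤ β * ‖∑ n, synthesis E (F.g_memLp n) a‖ ∧
    ‖∑ n, synthesis E (F.g_memLp n) a‖ ≤ β * ‖∑ n, θ n • synthesis E (F.g_memLp n) a‖ := by
  have hσ := H.sigmaFinite_vol
  have h := hβ.signUnconditional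
    (F.constitutesMDS_g (A := fun i : a.support => (i : D.Cube)) Subtype.val_injective fun i => a i)
    (fun i => memLp_smul_vec E (F.g_memLp i.1 i.2) (a i.2)) fun i => θ i.1
  have h1 : ∀ x, ∑ i : Fin M × a.support, θ i.1 • F.g i.1 i.2 x • a i.2
      = ∑ n, θ n • ∑ k : a.support, F.g n k x • a k := fun x => by
    rw [Fintype.sum_prod_type]
    simp only [Finset.smul_sum]
  have h2 : ∀ x, ∑ i : Fin M × a.support, F.g i.1 i.2 x • a i.2
      = ∑ n, ∑ k : a.support, F.g n k x • a k := fun x => by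
    rw [Fintype.sum_prod_type]
  simp only [h1, h2] at h
  rw [← enorm_sum_units_smul_Lp θ fun n => coeFn_synthesis (F.g_memLp n) a,
    ← enorm_sum_Lp fun n => coeFn_synthesis (F.g_memLp n) a] at h
  exact ⟨norm_le_mul_of_enorm_le h.1, norm_le_mul_of_enorm_le h.2⟩

theorem StripeFunctions.ae_sum_g_eq_zero (A : D.Cube) :
    ∀ᵐ x ∂H.vol, x ∉ A.carrier → ∑ n, F.g n A x = 0 := by
  filter_upwards [ae_all_iff.2 fun n => F.g_supp n A] with x hx hxA
  exact Finset.sum_eq_zero fun n _ => hx n fun h => hxA (S.sUnion_subset n A h)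

theorem StripeFunctions.signUnconditional_h (hβ : IsUMDBound.{u, v} E p β) {κ : Type*}
    [Fintype κ] {A : κ → D.Cube} (hA : Function.Injective A) (b : κ → E) :
    SignUnconditional p H.vol β fun k x => F.h (A k) x • b k :=
  have := H.sigmaFinite_vol
  hβ.signUnconditional ((F.h_mds.comp_injective hA).smul_vec b)
    fun k => memLp_smul_vec E (F.h_memLp (A k)) (b k)

theorem StripeFunctions.norm_sum_synthesis_le (hp : 1 ≤ p) (hp' : p ≠ ∞)
    (hβ : IsUMDBound.{u, v} E p β) {C_S : ℝ} (hC : 0 < C_S)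
    (hS : ∀ Q : D.Cube, eLpNorm (fun x => ∑ n, F.g n Q x) ∞ H.vol ≤
      ENNReal.ofReal C_S * ((H.vol Q.carrier)⁻¹ * ∫⁻ x, ‖F.h Q x‖ₑ ∂H.vol)) :
    ‖∑ n, synthesis E (F.g_memLp n) a‖
      ≤ ((β ^ 2 * (4 * (1 + β)) : ℝ≥0) : ℝ) * C_S * ‖synthesis E F.h_memLp a‖ := by
  have hσ := H.sigmaFinite_vol
  have hinj : Function.Injective fun i : a.support => (i : D.Cube) := Subtype.val_injective
  have h := hβ.eLpNorm_sum_smul_le_of_average hp hp'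
    (fun k : a.support => D.measurableSet_cube k.1.mem)
    (fun k => D.vol_cube_ne_zero k.1.mem) (fun k => D.vol_cube_ne_top k.1.mem)
    (D.nestedFamily_cubes _) (F.signUnconditional_sum_g hβ hinj fun k => a k)
    (F.signUnconditional_h hβ hinj fun k => a k)
    (fun k => memLp_finsetSum _ fun n _ => F.g_memLp n k) (fun k => F.h_memLp k)
    (fun k => F.ae_sum_g_eq_zero k) (fun k => F.h_supp k) C_S.toNNReal fun k => hS k
  rw [← F.enorm_sum_synthesis, ← eLpNorm_congr_ae (coeFn_synthesis F.h_memLp a),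
    ← Lp.enorm_def] at h
  have h' := norm_le_mul_of_enorm_le (C := β ^ 2 * (4 * (1 + β) * C_S.toNNReal))
    (x := ∑ n, synthesis E (F.g_memLp n) a) (y := synthesis E F.h_memLp a) (by push_cast; exact h)
  refine h'.trans (le_of_eq ?_)
  push_cast
  rw [Real.coe_toNNReal _ hC.le]
  ring

/-- The stripes of a cube are disjoint, so at almost every point at most one term is nonzero. This
puts the hypothesis of the second part into the form of an average of `|∑ n, g n A|`. -/
theorem StripeFunctions.sum_lintegral_g_le (A : D.Cube) :
    ∑ n, ∫⁻ x, ‖F.g n A x‖ₑ ∂H.vol ≤ ∫⁻ x, ‖∑ n, F.g n A x‖ₑ ∂H.vol := by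
  rw [← lintegral_finsetSum' _ fun n _ => (F.g_memLp n A).1.enorm]
  refine lintegral_mono_ae ?_
  filter_upwards [ae_all_iff.2 fun n => F.g_supp n A] with x hx
  by_cases h : ∃ n, x ∈ ⋃₀ S.stripe n A
  · obtain ⟨n, hn⟩ := h
    have h0 : ∀ n', n' ≠ n → F.g n' A x = 0 := fun n' hne =>
      hx n' fun h' => disjoint_left.1 (S.disjoint A n' n hne) h' hn
    rw [Finset.sum_eq_single n (fun n' _ hne => by rw [h0 n' hne, enorm_zero]) (by simp),
      Finset.sum_eq_single n (fun n' _ hne => h0 n' hne) (by simp)]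
  · push Not at h
    rw [Finset.sum_eq_zero fun n _ => by rw [hx n (h n), enorm_zero]]
    exact zero_le

theorem StripeFunctions.norm_synthesis_h_le (hp : 1 ≤ p) (hp' : p ≠ ∞)
    (hβ : IsUMDBound.{u, v} E p β) {C_S : ℝ} (hC : 0 < C_S)
    (hS : ∀ Q : D.Cube, eLpNorm (F.h Q) ∞ H.vol ≤
      ENNReal.ofReal C_S * ∑ n, (H.vol Q.carrier)⁻¹ * ∫⁻ x, ‖F.g n Q x‖ₑ ∂H.vol) :
    ‖synthesis E F.h_memLp a‖
      ≤ ((β ^ 2 * (4 * (1 + β)) : ℝ≥0) : ℝ) * C_S * ‖∑ n, synthesis E (F.g_memLp n) a‖ := by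
  have hσ := H.sigmaFinite_vol
  have hinj : Function.Injective fun i : a.support => (i : D.Cube) := Subtype.val_injective
  have h := hβ.eLpNorm_sum_smul_le_of_average hp hp'
    (fun k : a.support => D.measurableSet_cube k.1.mem)
    (fun k => D.vol_cube_ne_zero k.1.mem) (fun k => D.vol_cube_ne_top k.1.mem)
    (D.nestedFamily_cubes _) (F.signUnconditional_h hβ hinj fun k => a k)
    (F.signUnconditional_sum_g hβ hinj fun k => a k)
    (fun k => F.h_memLp k) (fun k => memLp_finsetSum _ fun n _ => F.g_memLp n k)
    (fun k => F.h_supp k) (fun k => F.ae_sum_g_eq_zero k) C_S.toNNReal fun k => by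
      refine (hS k).trans (mul_le_mul' le_rfl ?_)
      rw [← Finset.mul_sum]
      exact mul_le_mul' le_rfl (F.sum_lintegral_g_le k)
  rw [← F.enorm_sum_synthesis, ← eLpNorm_congr_ae (coeFn_synthesis F.h_memLp a),
    ← Lp.enorm_def] at h
  have h' := norm_le_mul_of_enorm_le (C := β ^ 2 * (4 * (1 + β) * C_S.toNNReal))
    (y := ∑ n, synthesis E (F.g_memLp n) a) (x := synthesis E F.h_memLp a) (by push_cast; exact h)
  refine h'.trans (le_of_eq ?_)
  push_cast
  rw [Real.coe_toNNReal _ hC.le]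
  ring

end Finite

/-! ### Closures of graphs -/

section Closure

variable {𝕜 V Y : Type*} [RCLike 𝕜] [AddCommGroup V] [Module 𝕜 V] [NormedAddCommGroup Y]
  [NormedSpace 𝕜 Y] (T R : V →ₗ[𝕜] Y)

/-- The inequality is a closed condition on the pair and holds on the graph. -/
theorem norm_le_of_mem_closure_graph {L : ℝ} (h : ∀ a, ‖R a‖ ≤ L * ‖T a‖) {z : Y × Y}
    (hz : z ∈ (LinearMap.range (T.prod R)).topologicalClosure) : ‖z.2‖ ≤ L * ‖z.1‖ := by
  have hcl : IsClosed {z : Y × Y | ‖z.2‖ ≤ L * ‖z.1‖} :=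
    isClosed_le continuous_snd.norm (continuous_const.mul continuous_fst.norm)
  refine closure_minimal ?_ hcl hz
  rintro _ ⟨a, rfl⟩
  exact h a

theorem mul_norm_le_of_mem_closure_graph {L : ℝ} (h : ∀ a, L * ‖T a‖ ≤ ‖R a‖) {z : Y × Y}
    (hz : z ∈ (LinearMap.range (T.prod R)).topologicalClosure) : L * ‖z.1‖ ≤ ‖z.2‖ := by
  have hcl : IsClosed {z : Y × Y | L * ‖z.1‖ ≤ ‖z.2‖} :=
    isClosed_le (continuous_const.mul continuous_fst.norm) continuous_snd.norm
  refine closure_minimal ?_ hcl hz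
  rintro _ ⟨a, rfl⟩
  exact h a

/-- The bound carries Cauchy sequences over from `T` to `R`, which gives existence. Uniqueness is
the bound on the closure, applied to the difference `(0, u' - u)`. -/
theorem existsUnique_mem_closure_graph [CompleteSpace Y] {L : ℝ} (h : ∀ a, ‖R a‖ ≤ L * ‖T a‖)
    {f : Y} (hf : f ∈ (LinearMap.range T).topologicalClosure) :
    ∃! u, (f, u) ∈ (LinearMap.range (T.prod R)).topologicalClosure := by
  obtain ⟨x, hx, hxf⟩ := mem_closure_iff_seq_limit.1 hf
  choose a ha using hx
  have hTa : Filter.Tendsto (fun n => T (a n)) Filter.atTop (nhds f) := by simpa only [ha] using hxf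
  have hR : CauchySeq fun n => R (a n) := by
    rw [cauchySeq_iff_tendsto_dist_atTop_0]
    have h0 := (cauchySeq_iff_tendsto_dist_atTop_0.1 hTa.cauchySeq).const_mul L
    rw [mul_zero] at h0
    refine squeeze_zero (fun _ => dist_nonneg) (fun n => ?_) h0
    rw [dist_eq_norm, dist_eq_norm, ← map_sub, ← map_sub]
    exact h _
  obtain ⟨u, hu⟩ := cauchySeq_tendsto_of_complete hR
  have hmem : (f, u) ∈ (LinearMap.range (T.prod R)).topologicalClosure :=
    mem_closure_of_tendsto (hTa.prodMk_nhds hu) (Filter.Eventually.of_forall fun n => ⟨a n, rfl⟩)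
  refine ⟨u, hmem, fun u' hu' => ?_⟩
  have h1 := norm_le_of_mem_closure_graph T R h (Submodule.sub_mem _ hu' hmem)
  simp only [Prod.mk_sub_mk, sub_self, norm_zero, mul_zero] at h1
  exact sub_eq_zero.1 (norm_le_zero_iff.1 h1)

end Closure

/-! ### Type and cotype for comparable vectors -/

section TypeCotype

variable {Y : Type*} [NormedAddCommGroup Y] {M : ℕ} (x : Fin M → Y)

theorem rademacherAvg_const (B : ℝ) : (2 ^ M : ℝ)⁻¹ * ∑ _ε : Fin M → ℤˣ, B = B := by
  rw [Finset.sum_const, Finset.card_univ, Fintype.card_fun, Fintype.card_units_int,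
    Fintype.card_fin, nsmul_eq_mul]
  push_cast
  rw [inv_mul_cancel_left₀ (by positivity)]

variable {x}

theorem rademacherAvg_le {B : ℝ} (h : ∀ θ : Fin M → ℤˣ, ‖∑ i, θ i • x i‖ ≤ B) :
    rademacherAvg x ≤ B := by
  rw [← rademacherAvg_const (M := M) B]
  exact mul_le_mul_of_nonneg_left (Finset.sum_le_sum fun θ _ => h θ) (by positivity)

theorem le_rademacherAvg {B : ℝ} (h : ∀ θ : Fin M → ℤˣ, B ≤ ‖∑ i, θ i • x i‖) :
    B ≤ rademacherAvg x := by
  conv_lhs => rw [← rademacherAvg_const (M := M) B]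
  exact mul_le_mul_of_nonneg_left (Finset.sum_le_sum fun θ _ => h θ) (by positivity)

/-- Lower estimates for the `ℓ^q` norm of vectors of comparable norm. -/
theorem norm_le_mul_sum_rpow {q K : ℝ} (hq : 0 < q) (hK : 0 ≤ K) (hM : 0 < M) {m : Fin M}
    (h : ∀ n, ‖x m‖ ≤ K * ‖x n‖) :
    ‖x m‖ ≤ K * (M : ℝ) ^ (-(1 / q)) * (∑ n, ‖x n‖ ^ q) ^ (1 / q) := by
  have hM' : (0 : ℝ) < M := by exact_mod_cast hM
  have h1 : (M : ℝ) * ‖x m‖ ^ q ≤ K ^ q * ∑ n, ‖x n‖ ^ q :=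
    calc (M : ℝ) * ‖x m‖ ^ q = ∑ _n : Fin M, ‖x m‖ ^ q := by simp
      _ ≤ ∑ n, K ^ q * ‖x n‖ ^ q := Finset.sum_le_sum fun n _ => by
          rw [← Real.mul_rpow hK (norm_nonneg _)]
          exact Real.rpow_le_rpow (norm_nonneg _) (h n) hq.le
      _ = _ := by rw [Finset.mul_sum]
  have h2 := Real.rpow_le_rpow (by positivity) h1 (z := 1 / q) (by positivity)
  rw [Real.mul_rpow hM'.le (by positivity), Real.mul_rpow (by positivity)
    (Finset.sum_nonneg fun _ _ => by positivity), ← Real.rpow_mul (norm_nonneg _),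
    ← Real.rpow_mul hK, mul_one_div_cancel hq.ne', Real.rpow_one, Real.rpow_one] at h2
  calc ‖x m‖ = (M : ℝ) ^ (-(1 / q)) * ((M : ℝ) ^ (1 / q) * ‖x m‖) := by
        rw [← mul_assoc, ← Real.rpow_add hM', neg_add_cancel, Real.rpow_zero, one_mul]
    _ ≤ (M : ℝ) ^ (-(1 / q)) * (K * (∑ n, ‖x n‖ ^ q) ^ (1 / q)) := by gcongr
    _ = _ := by ring

/-- Upper estimates for the `ℓ^q` norm of vectors of comparable norm. -/
theorem sum_rpow_le_mul_norm {q K : ℝ} (hq : 0 < q) (hK : 0 ≤ K) {m : Fin M}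
    (h : ∀ n, ‖x n‖ ≤ K * ‖x m‖) :
    (∑ n, ‖x n‖ ^ q) ^ (1 / q) ≤ (M : ℝ) ^ (1 / q) * (K * ‖x m‖) := by
  have h1 : ∑ n, ‖x n‖ ^ q ≤ M * (K * ‖x m‖) ^ q :=
    calc ∑ n, ‖x n‖ ^ q ≤ ∑ _n : Fin M, (K * ‖x m‖) ^ q :=
          Finset.sum_le_sum fun n _ => Real.rpow_le_rpow (norm_nonneg _) (h n) hq.le
      _ = _ := by simp
  refine (Real.rpow_le_rpow (Finset.sum_nonneg fun _ _ => by positivity) h1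
    (by positivity)).trans (le_of_eq ?_)
  rw [Real.mul_rpow (by positivity) (by positivity), ← Real.rpow_mul (by positivity),
    mul_one_div_cancel hq.ne', Real.rpow_one]

end TypeCotype

end

/-! ### The estimates for stripe operators from cotype and type -/

theorem theorem5p4 {X : Type u} [MeasurableSpace X] (H : HomogeneousSpace X) (D : DyadicSystem H)
    {𝕜 : Type*} [RCLike 𝕜]
    (E : Type v) [NormedAddCommGroup E] [NormedSpace ℝ E] [NormedSpace 𝕜 E] [IsScalarTower ℝ 𝕜 E]
    [CompleteSpace E] (hE : IsUMD.{u, v} E)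
    (p : ℝ≥0∞) [Fact (1 ≤ p)] (hp : 1 < p) (hp' : p ≠ ∞)
    (K₁ K₂ ε Cg : ℝ) (hK₁ : 0 < K₁) (hK₂ : 0 < K₂) (hε : 0 < ε) (hCg : 1 ≤ Cg) :
    (∀ 𝒞 : ℝ, HasCotype (Lp E p H.vol) 𝒞 → ∃ C : ℝ, 0 < C ∧
      ∀ (lam M : ℕ), 0 < lam → 0 < M →
      ∀ (S : Stripes D lam M K₁ K₂ ε) (F : StripeFunctions S 𝕜 p Cg) (C_S : ℝ), 0 < C_S →
        (∀ Q : D.Cube, eLpNorm (fun x => ∑ n, F.g n Q x) ∞ H.vol ≤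
          ENNReal.ofReal C_S * ((H.vol Q.carrier)⁻¹ * ∫⁻ x, ‖F.h Q x‖ₑ ∂H.vol)) →
        ∀ m : Fin M, ∀ f ∈ F.closedSpan E,
          (∃! u : Lp E p H.vol, (f, u) ∈ F.graph E m) ∧
            ∀ u : Lp E p H.vol, (f, u) ∈ F.graph E m →
              ‖u‖ ≤ C * C_S * (M : ℝ) ^ (-(1 / 𝒞)) * ‖f‖) ∧
    (∀ 𝒯 : ℝ, HasType (Lp E p H.vol) 𝒯 → ∃ C : ℝ, 0 < C ∧
      ∀ (lam M : ℕ), 0 < lam → 0 < M →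
      ∀ (S : Stripes D lam M K₁ K₂ ε) (F : StripeFunctions S 𝕜 p Cg) (C_S : ℝ), 0 < C_S →
        (∀ Q : D.Cube, eLpNorm (F.h Q) ∞ H.vol ≤
          ENNReal.ofReal C_S *
            ∑ n, (H.vol Q.carrier)⁻¹ * ∫⁻ x, ‖F.g n Q x‖ₑ ∂H.vol) →
        ∀ m : Fin M, ∀ f u : Lp E p H.vol, (f, u) ∈ F.graph E m →
          C * C_S⁻¹ * (M : ℝ) ^ (-(1 / 𝒯)) * ‖f‖ ≤ ‖u‖) := by
  obtain ⟨β, hβ⟩ := hE p hp hp'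
  have hβ : IsUMDBound.{u, v} E p β := hβ
  -- `k` and `θ`, and with them `Kc`, are fixed before `lam` and `M`, which makes the final
  -- constants uniform.
  obtain ⟨k, hk0, θ, hθ', hθ⟩ := exists_sum_Ico_le (K₁ := K₁) D.q_pos D.q_lt_one hK₂ hε
  obtain ⟨Kc, hKc⟩ : ∃ K : ℝ≥0, K = 1 + 2 * k * (sparseConst β K₁ Cg * (1 + β)) := ⟨_, rfl⟩
  obtain ⟨Ks, hKs⟩ : ∃ K : ℝ≥0, K = β ^ 2 * (4 * (1 + β)) := ⟨_, rfl⟩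
  have hcomp : ∀ (lam M : ℕ), 0 < lam → 0 < M → ∀ (S : Stripes D lam M K₁ K₂ ε)
      (F : StripeFunctions S 𝕜 p Cg) (m n : Fin M) (a : D.Cube →₀ E),
      ‖synthesis E (F.g_memLp m) a‖ ≤ Kc * ‖synthesis E (F.g_memLp n) a‖ :=
    fun lam M hlam hM S F m n a => hKc ▸
      F.norm_synthesis_le a hp.le hp' hβ hlam hM hk0 (hθ lam) hθ' m n
  constructor
  · rintro 𝒞 ⟨h𝒞, c', hc'⟩
    have h𝒞0 : 0 < 𝒞 := by linarith
    -- `Kc` compares the stripes, `c'` is the cotype constant, whose sign is not prescribed, `β`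
    -- removes the signs and `Ks` bounds the sum by `f`. The summand 1 ensures positivity.
    refine ⟨1 + Kc * (|c'| * (β * Ks)), by positivity, ?_⟩
    intro lam M hlam hM S F C_S hCS hS m f hf
    have key : ∀ a, ‖synthesis E (F.g_memLp m) a‖
        ≤ (1 + Kc * (|c'| * (β * Ks))) * C_S * (M : ℝ) ^ (-(1 / 𝒞)) * ‖synthesis E F.h_memLp a‖ := by
      intro a
      have h1 := norm_le_mul_sum_rpow (x := fun n => synthesis E (F.g_memLp n) a) h𝒞0
        Kc.coe_nonneg hM (m := m) fun n => hcomp lam M hlam hM S F m n a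
      have h2 := hc' M fun n => synthesis E (F.g_memLp n) a
      have h3 : rademacherAvg (fun n => synthesis E (F.g_memLp n) a)
          ≤ β * (Ks * C_S * ‖synthesis E F.h_memLp a‖) := by
        refine rademacherAvg_le fun θ => ((F.norm_sum_units_smul a hβ θ).1).trans ?_
        refine mul_le_mul_of_nonneg_left ?_ β.coe_nonneg
        rw [hKs]
        exact F.norm_sum_synthesis_le a hp.le hp' hβ hCS hS
      have h4 : 0 ≤ rademacherAvg (fun n => synthesis E (F.g_memLp n) a) :=
        le_rademacherAvg fun θ => norm_nonneg _
      have h5 : c' * rademacherAvg (fun n => synthesis E (F.g_memLp n) a)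
          ≤ |c'| * (β * (Ks * C_S * ‖synthesis E F.h_memLp a‖)) :=
        (mul_le_mul_of_nonneg_right (le_abs_self c') h4).trans
          (mul_le_mul_of_nonneg_left h3 (abs_nonneg _))
      calc ‖synthesis E (F.g_memLp m) a‖
          ≤ Kc * (M : ℝ) ^ (-(1 / 𝒞)) * (|c'| * (β * (Ks * C_S * ‖synthesis E F.h_memLp a‖))) :=
            h1.trans (mul_le_mul_of_nonneg_left (h2.trans h5) (by positivity))
        _ = Kc * (|c'| * (β * Ks)) * (C_S * (M : ℝ) ^ (-(1 / 𝒞)) * ‖synthesis E F.h_memLp a‖) := by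
            ring
        _ ≤ (1 + Kc * (|c'| * (β * Ks))) *
              (C_S * (M : ℝ) ^ (-(1 / 𝒞)) * ‖synthesis E F.h_memLp a‖) :=
            mul_le_mul_of_nonneg_right (by linarith) (by positivity)
        _ = _ := by ring
    refine ⟨existsUnique_mem_closure_graph (synthesis E F.h_memLp) (synthesis E (F.g_memLp m)) key
      hf, fun u hu => ?_⟩
    exact norm_le_of_mem_closure_graph (synthesis E F.h_memLp) (synthesis E (F.g_memLp m)) key
      (z := (f, u)) hu
  · rintro 𝒯 ⟨h𝒯, -, c', hc'⟩
    have h𝒯0 : 0 < 𝒯 := by linarith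
    refine ⟨(1 + Ks * (β * (|c'| * Kc)))⁻¹, by positivity, ?_⟩
    intro lam M hlam hM S F C_S hCS hS m f u hfu
    have hM' : (0 : ℝ) < M := by exact_mod_cast hM
    have key : ∀ a, (1 + Ks * (β * (|c'| * Kc)))⁻¹ * C_S⁻¹ * (M : ℝ) ^ (-(1 / 𝒯)) *
        ‖synthesis E F.h_memLp a‖ ≤ ‖synthesis E (F.g_memLp m) a‖ := by
      intro a
      have h1 := sum_rpow_le_mul_norm (x := fun n => synthesis E (F.g_memLp n) a) h𝒯0
        Kc.coe_nonneg (m := m) fun n => hcomp lam M hlam hM S F n m a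
      have h2 := hc' M fun n => synthesis E (F.g_memLp n) a
      have h3 : ‖∑ n, synthesis E (F.g_memLp n) a‖
          ≤ β * rademacherAvg (fun n => synthesis E (F.g_memLp n) a) := by
        have : ‖∑ n, synthesis E (F.g_memLp n) a‖ ≤ rademacherAvg
            (fun n => synthesis E (F.g_memLp n) a) * β := by
          -- The lower bound for the average requires division by `β`; if `β = 0`, the sum itself
          -- vanishes.
          rcases β.coe_nonneg.eq_or_lt with h0 | h0
          · have := (F.norm_sum_units_smul a hβ 1).2
            rw [← h0, zero_mul] at this
            rwa [← h0, mul_zero]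
          · rw [← div_le_iff₀ h0]
            refine le_rademacherAvg fun θ => ?_
            rw [div_le_iff₀' h0]
            exact (F.norm_sum_units_smul a hβ θ).2
        linarith
      have h4 : ‖synthesis E F.h_memLp a‖ ≤ Ks * C_S * ‖∑ n, synthesis E (F.g_memLp n) a‖ :=
        hKs ▸ F.norm_synthesis_h_le a hp.le hp' hβ hCS hS
      have h5 : c' * (∑ n, ‖synthesis E (F.g_memLp n) a‖ ^ 𝒯) ^ (1 / 𝒯)
          ≤ |c'| * ((M : ℝ) ^ (1 / 𝒯) * (Kc * ‖synthesis E (F.g_memLp m) a‖)) :=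
        (mul_le_mul_of_nonneg_right (le_abs_self c') (by positivity)).trans
          (mul_le_mul_of_nonneg_left h1 (abs_nonneg _))
      -- The chain runs from `h` to the sum of the stripe images, to their Rademacher average, by
      -- type to the `ℓ^𝒯` norm, and by comparability to the single index `m`.
      have h6 : ‖synthesis E F.h_memLp a‖ ≤ (1 + Ks * (β * (|c'| * Kc))) *
          (C_S * (M : ℝ) ^ (1 / 𝒯) * ‖synthesis E (F.g_memLp m) a‖) :=
        calc ‖synthesis E F.h_memLp a‖
            ≤ Ks * C_S * (β * (|c'| * ((M : ℝ) ^ (1 / 𝒯) *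
                (Kc * ‖synthesis E (F.g_memLp m) a‖)))) := by
              refine h4.trans (mul_le_mul_of_nonneg_left (h3.trans ?_) (by positivity))
              exact mul_le_mul_of_nonneg_left (h2.trans h5) β.coe_nonneg
          _ = Ks * (β * (|c'| * Kc)) *
                (C_S * (M : ℝ) ^ (1 / 𝒯) * ‖synthesis E (F.g_memLp m) a‖) := by ring
          _ ≤ _ := mul_le_mul_of_nonneg_right (by linarith) (by positivity)
      rw [Real.rpow_neg hM'.le]
      have hpos : 0 < 1 + Ks * (β * (|c'| * Kc)) := by positivity
      have hMp : 0 < (M : ℝ) ^ (1 / 𝒯) := by positivity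
      calc _ ≤ (1 + Ks * (β * (|c'| * Kc)))⁻¹ * C_S⁻¹ * ((M : ℝ) ^ (1 / 𝒯))⁻¹ *
            ((1 + Ks * (β * (|c'| * Kc))) *
              (C_S * (M : ℝ) ^ (1 / 𝒯) * ‖synthesis E (F.g_memLp m) a‖)) := by gcongr
        _ = _ := by field_simp
    exact mul_norm_le_of_mem_closure_graph (synthesis E F.h_memLp) (synthesis E (F.g_memLp m)) key
      (z := (f, u)) hfu
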